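/- **Setting.** Let $\wp$ be the Weierstrass function of a period lattice, let $e_1,e_2,e_3$ be the three (distinct) branch points of the associated curve $z^2=4(Z-e_1)(Z-e_2)(Z-e_3)$, and put $e=e_1$, $g=(e_1-e_2)(e_1-e_3)$, with a fixed square root $\sqrt g$. For $\kappa\in\mathbb C$ with $\kappa$ not a lattice point and $\wp(\kappa)\neq e$, put $$k=\frac12\frac{\wp'(\kappa)}{\wp(\kappa)-e},\qquad K=\wp(\kappa)-e,\qquad\text{so that } k^2=K+3e+\frac gK ,$$ and write $k',K'$ for the values at $\kappa'$. For $n\in\mathbb Z$ and real times $x_1,x_2,x_3,\dots$ (finitely many nonzero), let $$\rho_n(\kappa)=\exp\Big\{\sum_{j\ge0}k^{2j+1}x_{2j+1}+\sum_{j\ge1}\Big[K^j-\Big(\frac gK\Big)^j\Big]x_{2j}\Big\}\Big(\frac K{\sqrt g}\Big)^n,\qquad \Omega(\kappa,\kappa')=\frac{K-K'}{k+k'}=\frac{k-k'}{1-g/(KK')} .$$ Let $D$ be a compact set of pairs $(\kappa,\kappa')$ that is symmetric under $(\kappa,\kappa')\mapsto(\kappa',\kappa)$, let $\Gamma$ be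 its projection to the first factor, and let $d\zeta$ be a finite complex Borel measure on $D$ with $d\zeta(\kappa',\kappa)=-d\zeta(\kappa,\kappa')$. Assume that for every $\kappa\in\Gamma$ the pairs $(\lambda,\lambda')\in D$ for which $\Omega(\kappa,\lambda')$ is singular (i.e. $k(\kappa)+k(\lambda')=0$ and $K(\kappa)K(\lambda')=g$) are negligible, that $(\lambda,\lambda')\mapsto\Omega(\kappa,\lambda')$ is integrable against $|d\zeta|$, and that this function depends continuously on $\kappa\in\Gamma$ in $L^1(|d\zeta|)$. (All this is automatic if $\Omega$ has no singularity on $\Gamma\times\Gamma$, e.g. for soliton data.) Infinite vectors and matrices are understood through symbols: with $\Lambda$ the index shift, $\boldsymbol\Lambda=\tfrac12\wp'(\Lambda)/(\wp(\Lambda)-e)$ and $\boldsymbol L=\wp(\Lambda)-e$, the vector $\boldsymbol c(\kappa)=(\kappa^i)_{i\in\mathbb Z}$ satisfies $\boldsymbol\Lambda\boldsymbol c(\kappa)=k\,\boldsymbol c(\kappa)$ and $\boldsymbol L\boldsymbol c(\kappa)=K\boldsymbol c(\kappa)$; an infinite column vector $\boldsymbol a$ is given by all the values $(f(\Lambda)\boldsymbol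 a)^{(0)}$, linear in $f$, where $f$ runs through the algebra generated by the functions $\kappa^{\pm1},k,K^{\pm1}$, and similarly for matrices. The elliptic entries of a matrix $\boldsymbol U$ are $$\boldsymbol U^{[2i+a,\,2j+b]}=(\boldsymbol\Lambda^{a}\boldsymbol L^i\,\boldsymbol U\;{}^t\!\boldsymbol L^j\,{}^t\!\boldsymbol\Lambda^{b})^{(0,0)},\qquad a,b\in\{0,1\}.$$ **Theorem.** Fix $n$ and the times $x_4,x_5,\dots$, and let $O\subseteq\mathbb R^3$ be an open set of $(x_1,x_2,x_3)$ such that for every point of $O$ the homogeneous equation $$w(\kappa)+\iint_D d\zeta(\lambda,\lambda')\,\rho_n(\kappa)\Omega(\kappa,\lambda')\rho_n(\lambda')w(\lambda)=0\qquad(\kappa\in\Gamma)$$ has only the zero solution among continuous functions on $\Gamma$. Suppose that, at every point of $O$, the infinite vector $\boldsymbol u_n(\kappa)$, with components continuous in $\kappa\in\Gamma$, solves $$\boldsymbol u_n(\kappa)+\iint_D d\zeta(\lambda,\lambda')\,\rho_n(\kappa)\Omega(\kappa,\lambda')\rho_n(\lambda')\boldsymbol u_n(\lambda)=\rho_n(\kappa)\boldsymbol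 c(\kappa)\qquad(\kappa\in\Gamma).$$ Let $\boldsymbol U_n=\iint_D d\zeta(\kappa,\kappa')\,\boldsymbol u_n(\kappa)\,{}^t\boldsymbol c(\kappa')\rho_n(\kappa')$ and $$u_n=\boldsymbol U_n^{[2,0]},\qquad v_n=1+g^{-1}\boldsymbol U_n^{[3,2]},\qquad w_n=1-\boldsymbol U_n^{[1,0]} .$$ Then $u_n,v_n,w_n$ are smooth on $O$ and satisfy there the elliptic coupled Kadomtsev–Petviashvili (Date–Jimbo–Miwa) system $$\begin{aligned} \partial_3u_n&=\tfrac14\partial_1^3u_n+\tfrac32(\partial_1u_n)^2+\tfrac34\,\partial_1^{-1}\partial_2^2u_n+3g(1-v_nw_n),\\ \partial_3v_n&=-\tfrac12\partial_1^3v_n-3(\partial_1u_n-3e)\,\partial_1v_n+\tfrac32\partial_1\partial_2v_n+3(\partial_2u_n)v_n,\\ \partial_3w_n&=-\tfrac12\partial_1^3w_n-3(\partial_1u_n-3e)\,\partial_1w_n-\tfrac32\partial_1\partial_2w_n-3(\partial_2u_n)w_n, \end{aligned}$$ where $\partial_1^{-1}\partial_2^2u_n$ is a certain smooth function $Q$ on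 $O$ with $\partial_1Q=\partial_2^2u_n$. If $\operatorname{Re}(k+k')>0$ for all $(\kappa,\kappa')\in D$, this $Q$ satisfies $Q(x)=\int_{-\infty}^{x_1}\partial_2^2u_n(s,x_2,x_3)\,ds$ (absolutely convergent) for every $x$ such that $(s,x_2,x_3)\in O$ for all $s\le x_1$. If $\operatorname{Re}(k+k')<0$ for all $(\kappa,\kappa')\in D$, it satisfies $Q(x)=-\int_{x_1}^{\infty}\partial_2^2u_n(s,x_2,x_3)\,ds$ (absolutely convergent) for every $x$ such that $(s,x_2,x_3)\in O$ for all $s\ge x_1$. -/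

import Mathlib

open MeasureTheory Filter Topology

noncomputable section

namespace EllKP

/-- A Weierstrass curve `z² = 4 (Z - e₁) (Z - e₂) (Z - e₃)` uniformised by the `℘`-function of a
period lattice (so that `4 Z³ - g₂ Z - g₃ = 4 (Z - e₁) (Z - e₂) (Z - e₃)` for the invariants of that
lattice), with an ordering of its three distinct branch points and a choice of the square root of
`g = (e₁ - e₂) (e₁ - e₃)`. -/
structure Curve where
  /-- the period lattice -/
  P : PeriodPair
  e₁ : ℂ
  e₂ : ℂ
  e₃ : ℂ
  branch : ∀ Z : ℂ, 4 * Z ^ 3 - P.g₂ * Z - P.g₃ = 4 * (Z - e₁) * (Z - e₂) * (Z - e₃)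
  ne₁₂ : e₁ ≠ e₂
  ne₁₃ : e₁ ≠ e₃
  ne₂₃ : e₂ ≠ e₃
  /-- the chosen square root of `g` -/
  sqrtg : ℂ
  sqrtg_sq : sqrtg ^ 2 = (e₁ - e₂) * (e₁ - e₃)

namespace Curve

variable (E : Curve)

/-- The modulus `e = e₁`. -/
def e : ℂ := E.e₁

/-- The modulus `g = (e₁ - e₂) (e₁ - e₃)`. -/
def g : ℂ := (E.e₁ - E.e₂) * (E.e₁ - E.e₃)

/-- Values of the uniformising spectral parameter: `κ ∈ ℂ` at which `k`, `K` and `1 / K` are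
regular, i.e. `κ` is not a pole of `℘` and `℘(κ) ≠ e`. -/
abbrev Pt : Type := {κ : ℂ // κ ∉ E.P.lattice ∧ E.P.weierstrassP κ ≠ E.e₁}

/-- The coordinate `K = ℘(κ) - e`. -/
def K (κ : E.Pt) : ℂ := E.P.weierstrassP κ - E.e

/-- The coordinate `k = ℘'(κ) / (2 (℘(κ) - e))`. -/
def k (κ : E.Pt) : ℂ := 1 / 2 * (E.P.derivWeierstrassP κ / (E.P.weierstrassP κ - E.e))

/-! ### Infinite vectors and matrices

The index-raising operators `Λ`, `½ ℘'(Λ) / (℘(Λ) - e)` (bold Lambda) and `L = ℘(Λ) - e` are formal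
functions of the shift `Λ`, with joint eigenvectors `c(κ) = (κ^i)`, and with symbols `κ`, `k`, `K`.
An infinite column vector `a` is recorded by all the numbers `(f(Λ) a)^(0)`, linear in `f`, where
`f` runs through the algebra of symbols; its monomial components are `a^(i) = (Λ^i a)^(0)`. -/

/-- The algebra of symbols: all polynomials in `κ`, `κ⁻¹`, `k`, `K`, `K⁻¹`. -/
def Symb : Subalgebra ℂ (E.Pt → ℂ) :=
  Algebra.adjoin ℂ {fun κ : E.Pt => (κ : ℂ), fun κ : E.Pt => (κ : ℂ)⁻¹, E.k, E.K, fun κ => (E.K κ)⁻¹}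

/-- The symbol `k` of the bold operator Lambda. -/
def symK1 : E.Symb := ⟨E.k, Algebra.subset_adjoin (by simp)⟩

/-- The symbol `K` of `L`. -/
def symK2 : E.Symb := ⟨E.K, Algebra.subset_adjoin (by simp)⟩

/-- The symbol `1 / K` of `L⁻¹`. -/
def symK2inv : E.Symb := ⟨fun κ => (E.K κ)⁻¹, Algebra.subset_adjoin (by simp)⟩

/-- Infinite column vectors: `a f = (f(Λ) a)^(0)`. -/
abbrev InfCol : Type := E.Symb →ₗ[ℂ] ℂ

/-- The operator `f(Λ)` on infinite column vectors. -/
def act (f : E.Symb) (a : E.InfCol) : E.InfCol := a ∘ₗ LinearMap.mulLeft ℂ f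

/-- The infinite vector `c(κ) = (κ^i)`, on which `f(Λ)` acts as multiplication by `f(κ)`. -/
def c (κ : E.Pt) : E.InfCol where
  toFun f := (f : E.Pt → ℂ) κ
  map_add' _ _ := rfl
  map_smul' _ _ := rfl

/-- The eigenvalue equation of `c(κ)`; in particular `L c(κ) = K c(κ)`. -/
lemma act_c (f : E.Symb) (κ : E.Pt) : E.act f (E.c κ) = (f : E.Pt → ℂ) κ • E.c κ := rfl

/-- Infinite matrices: `U f f' = (f(Λ) U f'(ᵗΛ))^(0,0)`. -/
abbrev InfMat : Type := E.Symb → E.Symb → ℂ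

/-- The symbol of the elliptic label: `K^i` for the label `2 i` and `k K^i` for `2 i + 1`. -/
def labelSymb (i : ℤ) : E.Symb :=
  (if Odd i then E.symK1 else 1) * (E.symK2 ^ (i / 2).toNat * E.symK2inv ^ (-(i / 2)).toNat)

/-- The entry `U^[i,j]` in elliptic labels, e.g. `U^[2i+1,2j]` is the `(0,0)` entry of
`Λ L^i U ᵗL^j` (with bold Lambda). -/
def ellEntry {E : Curve} (U : E.InfMat) (i j : ℤ) : ℂ := U (E.labelSymb i) (E.labelSymb j)

/-! ### Plane wave factor and Cauchy kernel -/

/-- The dispersion of the `j`-th time: `k^j` for odd `j`, and `K^m - (g/K)^m` for `j = 2 m`. -/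
def disp (j : ℕ) (κ : E.Pt) : ℂ :=
  if Odd j then E.k κ ^ j else E.K κ ^ (j / 2) - (E.g / E.K κ) ^ (j / 2)

/-- The plane wave factor `ρ_n(κ)` at the times `x_{i+1} = x i` (`i = 0, 1, 2`) and
`x_{j+4} = y j` (`j = 0, 1, …`, only finitely many of them nonzero). -/
def planeWave (n : ℤ) (y : ℕ →₀ ℝ) (x : Fin 3 → ℝ) (κ : E.Pt) : ℂ :=
  Complex.exp ((∑ i : Fin 3, E.disp ((i : ℕ) + 1) κ * (x i : ℂ))
    + y.sum fun j t => E.disp (j + 4) κ * (t : ℂ)) * (E.K κ / E.sqrtg) ^ n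

/-- The singularities of the Cauchy kernel: both denominators vanish. -/
def KernelSingular (κ κ' : E.Pt) : Prop := E.k κ + E.k κ' = 0 ∧ E.K κ * E.K κ' = E.g

open Classical in
/-- The skew-symmetric Cauchy kernel
`Ω(κ,κ') = (K - K') / (k + k') = (k - k') / (1 - g / (K K'))`. On the curve the two quotients agree
where both are defined, and one of them is defined outside the singularities. -/
def kernel (κ κ' : E.Pt) : ℂ :=
  if E.k κ + E.k κ' ≠ 0 then (E.K κ - E.K κ') / (E.k κ + E.k κ')
  else (E.k κ - E.k κ') / (1 - E.g / (E.K κ * E.K κ'))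

/-- The domain `D` and the antisymmetric complex measure `dζ = dens dμ` of the integral equation:
`D` is compact, `ζ` is finite, and the (possibly weakly singular) Cauchy kernel is integrable,
`κ ↦ Ω(κ,·)` being continuous in the mean on the projection of `D`. The last three conditions
hold automatically if the projection of `D` contains no two points at which the kernel
is singular. -/
structure SpectralMeasure where
  D : Set (E.Pt × E.Pt)
  μ : Measure (E.Pt × E.Pt)
  dens : E.Pt × E.Pt → ℂ
  compact : IsCompact D
  finite : IsFiniteMeasure μ
  integrable : IntegrableOn dens D μ
  swap_mem : ∀ p ∈ D, p.swap ∈ D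
  swap_measure : MeasurePreserving Prod.swap (μ.restrict D) (μ.restrict D)
  antisymm : ∀ p ∈ D, dens p.swap = -dens p
  kernel_regular : ∀ κ ∈ Prod.fst '' D, ∀ᵐ p ∂μ.restrict D, ¬ E.KernelSingular κ p.2
  kernel_integrable : ∀ κ ∈ Prod.fst '' D, IntegrableOn (fun p => dens p * E.kernel κ p.2) D μ
  kernel_continuous : ∀ κ₀ ∈ Prod.fst '' D,
    Tendsto (fun κ => ∫ p in D, ‖dens p * E.kernel κ p.2 - dens p * E.kernel κ₀ p.2‖ ∂μ)
      (𝓝[Prod.fst '' D] κ₀) (𝓝 0)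

end Curve

namespace Curve.SpectralMeasure

variable {E : Curve} (ζ : E.SpectralMeasure)

/-- The spectral set, i.e. the projection of `D` (to either factor). -/
def spec : Set E.Pt := Prod.fst '' ζ.D

/-- The double integral `∬_D dζ(λ,λ') F(λ,λ')`. -/
def integral (F : E.Pt → E.Pt → ℂ) : ℂ := ∫ p in ζ.D, ζ.dens p * F p.1 p.2 ∂ζ.μ

/-- The linear integral equation
`w(κ) + ∬_D dζ(λ,λ') ρ(κ) Ω(κ,λ') ρ(λ') w(λ) = r(κ)` for one component `w`, on the
spectral set. -/
def IntegralEq (n : ℤ) (y : ℕ →₀ ℝ) (x : Fin 3 → ℝ) (r w : E.Pt → ℂ) : Prop :=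
  ∀ κ ∈ ζ.spec,
    w κ + ζ.integral (fun l l' =>
      E.planeWave n y x κ * E.kernel κ l' * E.planeWave n y x l' * w l) = r κ

/-- The infinite vector `u(κ)` solves the linear integral equation with right-hand side
`ρ_n(κ) c(κ)`, component by component. -/
def IsWaveFunction (n : ℤ) (y : ℕ →₀ ℝ) (x : Fin 3 → ℝ) (u : E.Pt → E.InfCol) : Prop :=
  ∀ f : E.Symb, ContinuousOn (fun κ => u κ f) ζ.spec ∧
    ζ.IntegralEq n y x (fun κ => E.planeWave n y x κ * E.c κ f) (fun κ => u κ f)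

/-- The homogeneous integral equation has only the zero solution. -/
def HomogeneousTrivial (n : ℤ) (y : ℕ →₀ ℝ) (x : Fin 3 → ℝ) : Prop :=
  ∀ w : E.Pt → ℂ, ContinuousOn w ζ.spec → ζ.IntegralEq n y x (fun _ => 0) w →
    ∀ κ ∈ ζ.spec, w κ = 0

/-- The potential matrix `U_n = ∬_D dζ(κ,κ') u_n(κ) ᵗc(κ') ρ_n(κ')`. -/
def potential (n : ℤ) (y : ℕ →₀ ℝ) (x : Fin 3 → ℝ) (u : E.Pt → E.InfCol) : E.InfMat :=
  fun f f' => ζ.integral (fun κ κ' => u κ f * E.c κ' f' * E.planeWave n y x κ')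

end Curve.SpectralMeasure

/-- The partial derivative `∂_j` with respect to `x_j = x (j - 1)`. -/
def pd (j : ℕ) (F : (Fin 3 → ℝ) → ℂ) (x : Fin 3 → ℝ) : ℂ :=
  fderiv ℝ F x (Pi.single (Fin.ofNat 3 (j - 1)) 1)

/-- The elliptic coupled KP system for `(u, v, w)` on the set `O`, where `∂₁⁻¹ ∂₂² u` is
represented by the function `Q`. -/
def SolvesEllCoupledKP (e g : ℂ) (O : Set (Fin 3 → ℝ)) (u v w Q : (Fin 3 → ℝ) → ℂ) : Prop :=
  ∀ x ∈ O,
    pd 3 u x = 1 / 4 * pd 1 (pd 1 (pd 1 u)) x + 3 / 2 * (pd 1 u x) ^ 2 + 3 / 4 * Q x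
      + 3 * g * (1 - v x * w x) ∧
    pd 3 v x = -(1 / 2) * pd 1 (pd 1 (pd 1 v)) x - 3 * (pd 1 u x - 3 * e) * pd 1 v x
      + 3 / 2 * pd 1 (pd 2 v) x + 3 * pd 2 u x * v x ∧
    pd 3 w x = -(1 / 2) * pd 1 (pd 1 (pd 1 w)) x - 3 * (pd 1 u x - 3 * e) * pd 1 w x
      - 3 / 2 * pd 1 (pd 2 w) x - 3 * pd 2 u x * w x

end EllKP

end

/-! Write `u_n = ρ_n w`. The integral equation becomes `w + S(ω · (w ∘ a)) = f`, where `S`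
integrates against `dζ` times the Cauchy kernel, `a` and `b` are the two projections of `D`, and all
times sit in the weight `ω(κ,κ') = ρ_n(κ) ρ_n(κ')`. Continuity of the kernel in the mean makes `S`
compact (Arzelà–Ascoli). By the Fredholm alternative, uniqueness for the homogeneous equation makes
the operator invertible, and the potentials inherit smoothness from inversion in a Banach algebra.

The weight satisfies `∂ω = (d(κ) + d(κ')) ω`, with `d` equal to `k`, `K - g/K`, `k³` for the three
times. For each of these, `(d(κ) + d(κ')) Ω(κ,κ')` is a finite sum of products `α(κ) β(κ')`, because
`(k + k') Ω = K - K'` and `(1 - g/(KK')) Ω = k - k'`. Differentiating the integral equation then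
closes up (`hasDerivAt_dressed`, `hasDerivAt_pot`): `∂ U(f,f') = U(df,f') + U(f,df') - ∑ U(f,β)
U(α,f')`. Moreover `U` is alternating, since both `Ω` and `dζ` are antisymmetric
(`Solvable.pot_antisymm`).

These facts and the curve equation form the algebraic structure `EllipticFlow`. In it every
derivative of an elliptic entry is a polynomial in elliptic entries, and the system reduces to the
polynomial identities `D₃_entry_two_zero`, `D₃_entry_three_two` and `D₃_entry_one_zero`. The
nonlocal term is `Q = ∂₂(U^[3,0] - U^[2,1])`, with `∂₁Q = ∂₂²u` by `D₁_D₂_entry_sub_entry`.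

On a half line along which the weight decays exponentially, so does every potential, hence every
polynomial in potentials without constant term. `Q` and `∂₁Q` are of this kind, so the fundamental
theorem of calculus gives the integral formulas. -/

noncomputable section

namespace EllKP

/-! ### Families of functionals as compact operators -/

section FamilyOperator

variable {X : Type*} [TopologicalSpace X] [CompactSpace X]
  {V : Type*} [NormedAddCommGroup V] [NormedSpace ℂ V]

/-- The operator `h ↦ (x ↦ φ x h)` of a norm continuous family `φ` of functionals. -/
def familyOp (φ : C(X, V →L[ℂ] ℂ)) : V →L[ℂ] C(X, ℂ) :=
  LinearMap.mkContinuous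
    { toFun := fun h => ⟨fun x => φ x h, by fun_prop⟩
      map_add' := fun h h' => by ext x; simp
      map_smul' := fun r h => by ext x; simp } ‖φ‖ fun h =>
    (ContinuousMap.norm_le _ (by positivity)).2 fun x =>
      (φ x).le_of_opNorm_le (φ.norm_coe_le_norm x) h

/-- For `‖h‖ ≤ 1` one has `|φ x h - φ x₀ h| ≤ ‖φ x - φ x₀‖`, so the image of the unit ball is
equicontinuous and bounded, and Arzelà–Ascoli applies. -/
lemma isCompactOperator_familyOp (φ : C(X, V →L[ℂ] ℂ)) : IsCompactOperator (familyOp φ) := by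
  -- Arzelà–Ascoli is used for bounded continuous functions and carried back along this isometry.
  let e := ContinuousMap.isometryEquivBoundedOfCompact X ℂ
  rw [show (⇑(familyOp φ) : V → C(X, ℂ)) = ⇑(familyOp φ : V →ₗ[ℂ] C(X, ℂ)) from rfl,
    isCompactOperator_iff_isCompact_closure_image_closedBall _ one_pos]
  have hA : IsCompact (closure (e '' (familyOp φ '' Metric.closedBall 0 1))) := by
    refine BoundedContinuousFunction.arzela_ascoli (Metric.closedBall (0 : ℂ) ‖familyOp φ‖)
      (isCompact_closedBall _ _) _ ?_ ?_
    · rintro _ x ⟨_, ⟨h, hh, rfl⟩, rfl⟩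
      rw [mem_closedBall_zero_iff] at hh ⊢
      calc ‖familyOp φ h x‖ ≤ ‖familyOp φ h‖ := (familyOp φ h).norm_coe_le_norm x
        _ ≤ ‖familyOp φ‖ * ‖h‖ := (familyOp φ).le_opNorm h
        _ ≤ ‖familyOp φ‖ * 1 := by gcongr
        _ = _ := mul_one _
    · intro x₀
      rw [Metric.equicontinuousAt_iff_right]
      intro ε hε
      have := (Metric.tendsto_nhds.1 (φ.continuous.tendsto x₀)) ε hε
      filter_upwards [this] with x hx
      rintro ⟨_, ⟨_, ⟨h, hh, rfl⟩, rfl⟩⟩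
      rw [mem_closedBall_zero_iff] at hh
      change dist (φ x₀ h) (φ x h) < ε
      rw [dist_comm, dist_eq_norm, ← sub_apply]
      refine lt_of_le_of_lt ?_ hx
      rw [dist_eq_norm]
      calc _ ≤ ‖φ x - φ x₀‖ * ‖h‖ := (φ x - φ x₀).le_opNorm h
        _ ≤ ‖φ x - φ x₀‖ * 1 := by gcongr
        _ = _ := mul_one _
  have := hA.image e.symm.continuous
  rwa [← IsometryEquiv.coe_toHomeomorph, Homeomorph.image_closure, IsometryEquiv.coe_toHomeomorph,
    ← Set.image_comp, e.symm_comp_self, Set.image_id] at this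

end FamilyOperator

/-- Fredholm alternative at `-1`: a nonzero spectral value of a compact operator is an eigenvalue,
and `hinj` excludes an eigenvector. -/
lemma isUnit_one_add_of_isCompactOperator {H : Type*} [NormedAddCommGroup H] [NormedSpace ℂ H]
    [CompleteSpace H] {T : H →L[ℂ] H} (hT : IsCompactOperator T)
    (hinj : ∀ w, w + T w = 0 → w = 0) : IsUnit (1 + T) := by
  rcases hT.hasEigenvalue_or_mem_resolventSet (μ := -1) (by simp) with h | h
  · obtain ⟨w, hw⟩ := h.exists_hasEigenvector
    refine absurd (hinj w ?_) hw.2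
    have : T w = (-1 : ℂ) • w := hw.apply_eq_smul
    rw [this]; simp
  · rw [spectrum.mem_resolventSet_iff] at h
    convert h.neg using 1
    simp [add_comm]

/-! ### Integral operators with an antisymmetric kernel -/

/-- The `L¹` norm of `G x` is continuous in `x`, hence bounded on a compact space. The uniform bound
is what Fubini needs in `integral_kernel_antisymm`. -/
lemma exists_integral_norm_le {X Y : Type*} [TopologicalSpace X] [CompactSpace X]
    [MeasurableSpace Y] {ν : Measure Y} (G : X → Y → ℂ) (hG : ∀ x, Integrable (G x) ν)
    (hc : ∀ x₀, Tendsto (fun x => ∫ p, ‖G x p - G x₀ p‖ ∂ν) (𝓝 x₀) (𝓝 0)) :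
    ∃ M, ∀ x, ∫ p, ‖G x p‖ ∂ν ≤ M := by
  have hcont : Continuous fun x => ∫ p, ‖G x p‖ ∂ν := by
    rw [continuous_iff_continuousAt]
    intro x₀
    rw [ContinuousAt, tendsto_iff_norm_sub_tendsto_zero]
    refine squeeze_zero (fun _ => norm_nonneg _) (fun x => ?_) (hc x₀)
    rw [← integral_sub (hG x).norm (hG x₀).norm]
    refine (norm_integral_le_integral_norm _).trans ?_
    refine integral_mono ((hG x).norm.sub (hG x₀).norm).norm ((hG x).sub (hG x₀)).norm fun p => ?_
    exact abs_norm_sub_norm_le _ _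
  obtain ⟨M, hM⟩ := (isCompact_range hcont).bddAbove
  exact ⟨M, fun x => hM ⟨x, rfl⟩⟩

section KernelOperator

variable {X Y : Type*} [TopologicalSpace X]
  [TopologicalSpace Y] [CompactSpace Y] [MeasurableSpace Y] [OpensMeasurableSpace Y]
  {ν : Measure Y}

lemma Integrable.mul_continuousMap {f : Y → ℂ} (hf : Integrable f ν) (h : C(Y, ℂ)) :
    Integrable (fun p => f p * h p) ν :=
  hf.mul_bdd (c := ‖h‖) h.continuous.aestronglyMeasurable (ae_of_all _ fun p => h.norm_coe_le_norm p)

/-- The functional `h ↦ ∫ f h dν` of an integrable function `f`. -/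
def integralFunctional (f : Y → ℂ) (hf : Integrable f ν) : C(Y, ℂ) →L[ℂ] ℂ :=
  LinearMap.mkContinuous
    { toFun := fun h => ∫ p, f p * h p ∂ν
      map_add' := fun h h' => by
        simp only [ContinuousMap.add_apply, mul_add]
        exact integral_add (Integrable.mul_continuousMap hf h) (Integrable.mul_continuousMap hf h')
      map_smul' := fun r h => by
        simp only [ContinuousMap.smul_apply, smul_eq_mul, mul_left_comm, RingHom.id_apply]
        exact integral_const_mul _ _ } (∫ p, ‖f p‖ ∂ν) fun h => by
    change ‖∫ p, f p * h p ∂ν‖ ≤ _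
    refine (norm_integral_le_integral_norm _).trans ?_
    rw [← integral_mul_const]
    refine integral_mono (Integrable.mul_continuousMap hf h).norm (hf.norm.mul_const _) fun p => ?_
    simp only [norm_mul]
    gcongr
    exact h.norm_coe_le_norm p

lemma integralFunctional_apply (f : Y → ℂ) (hf : Integrable f ν) (h : C(Y, ℂ)) :
    integralFunctional f hf h = ∫ p, f p * h p ∂ν := rfl

lemma norm_integralFunctional_le (f : Y → ℂ) (hf : Integrable f ν) :
    ‖integralFunctional f hf‖ ≤ ∫ p, ‖f p‖ ∂ν :=
  LinearMap.mkContinuous_norm_le _ (integral_nonneg fun _ => norm_nonneg _) _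

lemma integralFunctional_sub (f f' : Y → ℂ) (hf : Integrable f ν) (hf' : Integrable f' ν) :
    integralFunctional f hf - integralFunctional f' hf' =
      integralFunctional (f - f') (hf.sub hf') := by
  ext h
  simp only [sub_apply, integralFunctional_apply, Pi.sub_apply, sub_mul]
  exact (integral_sub (Integrable.mul_continuousMap hf h)
    (Integrable.mul_continuousMap hf' h)).symm

/-- The functionals of a family of integrable functions that is continuous in the mean. -/
def integralFamily (G : X → Y → ℂ) (hG : ∀ x, Integrable (G x) ν)
    (hc : ∀ x₀, Tendsto (fun x => ∫ p, ‖G x p - G x₀ p‖ ∂ν) (𝓝 x₀) (𝓝 0)) :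
    C(X, C(Y, ℂ) →L[ℂ] ℂ) where
  toFun x := integralFunctional (G x) (hG x)
  continuous_toFun := by
    rw [continuous_iff_continuousAt]
    intro x₀
    rw [ContinuousAt, tendsto_iff_norm_sub_tendsto_zero]
    refine squeeze_zero (fun _ => norm_nonneg _) (fun x => ?_) (hc x₀)
    rw [integralFunctional_sub]
    exact norm_integralFunctional_le _ _

/-- An operator with kernel `dens(q) Ω(x, b(q))`, where `Ω` is antisymmetric, is antisymmetric
with respect to `dens dν`. -/
lemma integral_kernel_antisymm {X : Type*} [SFinite ν] {b : Y → X} {dens : Y → ℂ}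
    {Ω : X → X → ℂ} (hdens : Integrable dens ν)
    (hmeas : AEStronglyMeasurable (fun z : Y × Y => Ω (b z.1) (b z.2)) (ν.prod ν))
    (hanti : ∀ x x', Ω x x' = -Ω x' x)
    (hint : ∀ x, Integrable (fun p => dens p * Ω x (b p)) ν)
    {M : ℝ} (hM : ∀ x, ∫ p, ‖dens p * Ω x (b p)‖ ∂ν ≤ M) (h h' : C(Y, ℂ)) :
    ∫ p, dens p * (h p * ∫ q, dens q * Ω (b p) (b q) * h' q ∂ν) ∂ν =
      -∫ p, dens p * (h' p * ∫ q, dens q * Ω (b p) (b q) * h q ∂ν) ∂ν := by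
  -- Joint integrability for Fubini: the inner `L¹` norm is at most `‖dens p‖ ‖h‖ M ‖h'‖`,
  -- integrable in `p` because `M` does not depend on `p`.
  have hF : Integrable (fun z : Y × Y => dens z.1 * h z.1 *
      (dens z.2 * Ω (b z.1) (b z.2) * h' z.2)) (ν.prod ν) := by
    have hsm : AEStronglyMeasurable (fun z : Y × Y => dens z.1 * h z.1 *
        (dens z.2 * Ω (b z.1) (b z.2) * h' z.2)) (ν.prod ν) :=
      ((hdens.1.comp_fst.mul (h.continuous.aestronglyMeasurable (μ := ν)).comp_fst)).mul
        ((hdens.1.comp_snd.mul hmeas).mul (h'.continuous.aestronglyMeasurable (μ := ν)).comp_snd)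
    rw [integrable_prod_iff hsm]
    refine ⟨ae_of_all _ fun p => (Integrable.mul_continuousMap (hint (b p)) h').const_mul
      (dens p * h p), ?_⟩
    refine Integrable.mono' (g := fun p => ‖dens p‖ * (‖h‖ * (M * ‖h'‖))) (hdens.norm.mul_const _)
      (hsm.norm.integral_prod_right') (ae_of_all _ fun p => ?_)
    rw [Real.norm_of_nonneg (integral_nonneg fun _ => norm_nonneg _)]
    simp only [norm_mul (dens p * h p)]
    rw [integral_const_mul, norm_mul, mul_assoc]
    gcongr
    · exact h.norm_coe_le_norm p
    · refine le_trans ?_ (mul_le_mul_of_nonneg_right (hM (b p)) (norm_nonneg h'))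
      rw [← integral_mul_const]
      refine integral_mono (Integrable.mul_continuousMap (hint (b p)) h').norm
        ((hint (b p)).norm.mul_const _) fun q => ?_
      simp only [norm_mul _ (h' q)]
      gcongr
      exact h'.norm_coe_le_norm q
  calc ∫ p, dens p * (h p * ∫ q, dens q * Ω (b p) (b q) * h' q ∂ν) ∂ν
      = ∫ p, ∫ q, dens p * h p * (dens q * Ω (b p) (b q) * h' q) ∂ν ∂ν := by
        simp only [integral_const_mul, mul_assoc]
    _ = ∫ q, ∫ p, dens p * h p * (dens q * Ω (b p) (b q) * h' q) ∂ν ∂ν :=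
        integral_integral_swap hF
    _ = ∫ q, -(dens q * (h' q * ∫ p, dens p * Ω (b q) (b p) * h p ∂ν)) ∂ν := by
        congr 1; ext q
        rw [← mul_assoc, ← integral_const_mul, ← integral_neg]
        congr 1; ext p
        rw [hanti (b p)]; ring
    _ = _ := integral_neg _

/-- A kernel on which multiplication by `d(x) + d(b(p))` has finite rank gives an operator whose
anticommutator with `d` has finite rank. -/
lemma integral_kernel_degenerate {ι : Type*} [Fintype ι] {b : C(Y, X)} {dens : Y → ℂ}
    {Ω : X → X → ℂ} (hdens : Integrable dens ν)
    (hint : ∀ x, Integrable (fun p => dens p * Ω x (b p)) ν)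
    {d : C(X, ℂ)} {α β : ι → C(X, ℂ)}
    (hdeg : ∀ x, ∀ᵐ p ∂ν, (d x + d (b p)) * Ω x (b p) = ∑ i, α i x * β i (b p))
    (h : C(Y, ℂ)) (x : X) :
    ∫ p, dens p * Ω x (b p) * (d.comp b * h) p ∂ν + d x * ∫ p, dens p * Ω x (b p) * h p ∂ν =
      ∑ i, (∫ p, dens p * ((β i).comp b * h) p ∂ν) * α i x := by
  rw [← integral_const_mul, ← integral_add (Integrable.mul_continuousMap (hint x) _)
    ((Integrable.mul_continuousMap (hint x) _).const_mul _)]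
  simp only [← integral_mul_const]
  rw [← integral_finsetSum _
    fun i _ => (Integrable.mul_continuousMap hdens ((β i).comp b * h)).mul_const _]
  refine integral_congr_ae ?_
  filter_upwards [hdeg x] with p hp
  simp only [ContinuousMap.mul_apply, ContinuousMap.comp_apply]
  calc _ = dens p * h p * ((d x + d (b p)) * Ω x (b p)) := by ring
    _ = _ := by
      rw [hp, Finset.mul_sum]
      exact Finset.sum_congr rfl fun i _ => by ring

end KernelOperator

/-! ### Inversion of `1 + T ω` and its smooth dependence on the parameter -/

section InverseOneAdd

variable {V H : Type*} [NormedAddCommGroup V] [NormedSpace ℂ V] [NormedAddCommGroup H]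
  [NormedSpace ℂ H] [CompleteSpace H]

lemma eventually_isUnit_one_add (T : V →L[ℂ] H →L[ℂ] H) {ω : V} (hω : IsUnit (1 + T ω)) :
    ∀ᶠ ω' in 𝓝 ω, IsUnit (1 + T ω') := by
  have hc : Continuous fun ω => 1 + T ω := by fun_prop
  exact hc.continuousAt.eventually (Units.isOpen.mem_nhds hω)

lemma contDiffAt_inverse_one_add (T : V →L[ℂ] H →L[ℂ] H) {ω : V} (hω : IsUnit (1 + T ω)) (f : H)
    {m : WithTop ℕ∞} : ContDiffAt ℂ m (fun ω => Ring.inverse (1 + T ω) f) ω := by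
  have h1 : ContDiffAt ℂ m Ring.inverse (1 + T ω) := by
    have := contDiffAt_ringInverse ℂ (n := m) (IsUnit.unit hω)
    rwa [IsUnit.unit_spec] at this
  have h2 : ContDiffAt ℂ m (fun ω => 1 + T ω) ω := contDiffAt_const.add T.contDiff.contDiffAt
  exact (h1.comp ω h2).clm_apply contDiffAt_const

end InverseOneAdd

/-! ### Dressing by a weighted integral operator -/

/-- The composition operator `w ↦ w ∘ a` on continuous functions. -/
def pullback {X Y : Type*} [TopologicalSpace X] [CompactSpace X] [TopologicalSpace Y]
    [CompactSpace Y] (a : C(Y, X)) : C(X, ℂ) →L[ℂ] C(Y, ℂ) :=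
  ⟨(ContinuousMap.compRightAlgHom ℂ ℂ a).toLinearMap, ContinuousMap.continuous_precomp a⟩

section Pullback

variable {X Y : Type*} [TopologicalSpace X] [CompactSpace X] [TopologicalSpace Y] [CompactSpace Y]

@[simp]
lemma pullback_apply (a : C(Y, X)) (w : C(X, ℂ)) (p : Y) : pullback a w p = w (a p) := rfl

lemma pullback_mul (a : C(Y, X)) (w w' : C(X, ℂ)) :
    pullback a (w * w') = pullback a w * pullback a w' := rfl

end Pullback

/-- An operator `S` and a functional `Φ` on the functions on `Y`, where `Y` maps to `X` by `a`
and `b`. The operators to be inverted are `1 + S (ω · (w ∘ a))`, with weights `ω` on `Y`. -/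
structure Dressing (X Y : Type*) [TopologicalSpace X] [CompactSpace X] [TopologicalSpace Y]
    [CompactSpace Y] where
  a : C(Y, X)
  b : C(Y, X)
  S : C(Y, ℂ) →L[ℂ] C(X, ℂ)
  Φ : C(Y, ℂ) →L[ℂ] ℂ
  antisymm : ∀ h h', Φ (h * pullback b (S h')) = -Φ (h' * pullback b (S h))

namespace Dressing

variable {X Y : Type*} [TopologicalSpace X] [CompactSpace X] [TopologicalSpace Y] [CompactSpace Y]
  (A : Dressing X Y)

/-- The weighted operator `w ↦ S (ω · (w ∘ a))`, as a function of the weight `ω`. -/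
def weighted : C(Y, ℂ) →L[ℂ] C(X, ℂ) →L[ℂ] C(X, ℂ) :=
  (((ContinuousLinearMap.compL ℂ (C(X, ℂ)) (C(Y, ℂ)) (C(X, ℂ))).flip (pullback A.a)).comp
    (ContinuousLinearMap.compL ℂ (C(Y, ℂ)) (C(Y, ℂ)) (C(X, ℂ)) A.S)).comp
    (ContinuousLinearMap.mul ℂ (C(Y, ℂ)))

@[simp]
lemma weighted_apply (ω : C(Y, ℂ)) (w : C(X, ℂ)) :
    A.weighted ω w = A.S (ω * pullback A.a w) := rfl

/-- The solution `w` of `w + S (ω · (w ∘ a)) = f`. -/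
def dressed (ω : C(Y, ℂ)) : C(X, ℂ) →L[ℂ] C(X, ℂ) := Ring.inverse (1 + A.weighted ω)

/-- The potential `Φ (ω · (w ∘ a) · (f' ∘ b))`, where `w` is the dressed function `f`. -/
def pot (ω : C(Y, ℂ)) : C(X, ℂ) →ₗ[ℂ] C(X, ℂ) →ₗ[ℂ] ℂ :=
  LinearMap.mk₂ ℂ (fun f f' => A.Φ (ω * pullback A.a (A.dressed ω f) * pullback A.b f'))
    (fun f₁ f₂ f' => by simp only [map_add, mul_add, add_mul])
    (fun r f f' => by simp only [map_smul, mul_smul_comm, smul_mul_assoc])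
    (fun f f₁ f₂ => by simp only [map_add, mul_add])
    (fun r f f' => by simp only [map_smul, mul_smul_comm])

lemma pot_apply (ω : C(Y, ℂ)) (f f' : C(X, ℂ)) :
    A.pot ω f f' = A.Φ (ω * pullback A.a (A.dressed ω f) * pullback A.b f') := rfl

/-- The weights for which the dressing problem is uniquely solvable. -/
def Solvable (ω : C(Y, ℂ)) : Prop := IsUnit (1 + A.weighted ω)

variable {A}

lemma Solvable.eventually {ω : C(Y, ℂ)} (hω : A.Solvable ω) : ∀ᶠ ω' in 𝓝 ω, A.Solvable ω' := 
  eventually_isUnit_one_add A.weighted hω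

lemma Solvable.dressed_add {ω : C(Y, ℂ)} (hω : A.Solvable ω) (f : C(X, ℂ)) :
    A.dressed ω f + A.S (ω * pullback A.a (A.dressed ω f)) = f :=
  congr($(Ring.mul_inverse_cancel _ hω) f)

lemma Solvable.eq_dressed {ω : C(Y, ℂ)} (hω : A.Solvable ω) {f w : C(X, ℂ)}
    (hw : w + A.S (ω * pullback A.a w) = f) : w = A.dressed ω f := by
  rw [← hw]
  exact congr($(Ring.inverse_mul_cancel _ hω) w).symm

/-- Replacing `f'` by `w' + S(ω · (w' ∘ a))`, with `w'` the dressed `f'`, splits the potential into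
a term antisymmetric by `hsymm` and a term antisymmetric by the antisymmetry of `S`. -/
lemma Solvable.pot_antisymm {ω : C(Y, ℂ)} (hω : A.Solvable ω)
    (hsymm : ∀ w w', A.Φ (ω * pullback A.a w * pullback A.b w') =
      -A.Φ (ω * pullback A.a w' * pullback A.b w)) (f f' : C(X, ℂ)) :
    A.pot ω f f' = -A.pot ω f' f := by
  have key : ∀ f f', A.pot ω f f' =
      A.Φ (ω * pullback A.a (A.dressed ω f) * pullback A.b (A.dressed ω f')) +
      A.Φ (ω * pullback A.a (A.dressed ω f) *
        pullback A.b (A.S (ω * pullback A.a (A.dressed ω f')))) := fun f f' => by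
    rw [pot_apply, ← map_add, ← mul_add, ← map_add, hω.dressed_add]
  rw [key, key, hsymm, A.antisymm, neg_add]

lemma Solvable.contDiffAt_dressed {ω : C(Y, ℂ)} (hω : A.Solvable ω) (f : C(X, ℂ))
    {m : WithTop ℕ∞} : ContDiffAt ℂ m (fun ω => A.dressed ω f) ω :=
  contDiffAt_inverse_one_add A.weighted hω f

lemma Solvable.contDiffAt_pot {ω : C(Y, ℂ)} (hω : A.Solvable ω) (f f' : C(X, ℂ))
    {m : WithTop ℕ∞} : ContDiffAt ℂ m (fun ω => A.pot ω f f') ω := by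
  have h1 := (pullback A.a).contDiff.contDiffAt.comp ω (hω.contDiffAt_dressed f (m := m))
  exact A.Φ.contDiff.contDiffAt.comp ω
    ((contDiffAt_id.mul h1).mul (contDiffAt_const (c := pullback A.b f')))

/-- Evolution of the dressed functions when the weight evolves by `ω' = (d ∘ a + d ∘ b) ω` and the
anticommutator of `S` with `d` has finite rank. -/
lemma hasDerivAt_dressed {ι : Type*} [Fintype ι] {d : C(X, ℂ)} {α β : ι → C(X, ℂ)}
    (hdeg : ∀ h, A.S (pullback A.b d * h) + d * A.S h = ∑ i, A.Φ (pullback A.b (β i) * h) • α i)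
    {W : ℝ → C(Y, ℂ)} {t : ℝ} (hW : HasDerivAt W ((pullback A.a d + pullback A.b d) * W t) t)
    (hω : A.Solvable (W t)) (f : C(X, ℂ)) :
    HasDerivAt (fun s => A.dressed (W s) f)
      (A.dressed (W t) (d * f) - d * A.dressed (W t) f -
        ∑ i, A.pot (W t) f (β i) • A.dressed (W t) (α i)) t := by
  set w := A.dressed (W t) f with hw
  obtain ⟨w', hw'⟩ : ∃ w', HasDerivAt (fun s => A.dressed (W s) f) w' t :=
    ⟨_, (((hω.contDiffAt_dressed f (m := 1)).differentiableAt
      one_ne_zero).hasFDerivAt.restrictScalars ℝ).comp_hasDerivAt t hW⟩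
  have hinj : ∀ v₁ v₂ : C(X, ℂ), v₁ + A.S (W t * pullback A.a v₁) =
      v₂ + A.S (W t * pullback A.a v₂) → v₁ = v₂ := fun v₁ v₂ h =>
    (hω.eq_dressed h).trans (hω.eq_dressed rfl).symm
  have h0 : w' + A.S ((pullback A.a d + pullback A.b d) * W t * pullback A.a w +
      W t * pullback A.a w') = 0 := by
    have h1 : HasDerivAt (fun s => pullback A.a (A.dressed (W s) f)) (pullback A.a w') t :=
      ((pullback A.a).restrictScalars ℝ).hasFDerivAt.comp_hasDerivAt t hw'
    have h2 := (A.S.restrictScalars ℝ).hasFDerivAt.comp_hasDerivAt t (hW.mul h1)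
    refine (hw'.add h2).unique ((hasDerivAt_const t f).congr_of_eventuallyEq ?_)
    filter_upwards [hW.continuousAt.eventually hω.eventually] with s hs
    exact Solvable.dressed_add hs f
  convert hw' using 1
  -- Both candidates for the derivative are compared after applying the injective operator `1 +
  -- A.weighted (W t)`. By `hdeg`, the term `S((d ∘ b) · h)` becomes `-d · S h` plus finite rank
  -- terms, and `S h = f - w` for `h = W t · (w ∘ a)`.
  refine hinj _ _ ?_
  have hS := hω.dressed_add f
  rw [← hw] at hS
  have hD := hdeg (W t * pullback A.a w)
  have hP : ∀ i, A.Φ (pullback A.b (β i) * (W t * pullback A.a w)) = A.pot (W t) f (β i) :=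
    fun i => by rw [pot_apply, mul_comm]
  have hSα : ∀ i, A.S (W t * pullback A.a (A.dressed (W t) (α i))) =
      α i - A.dressed (W t) (α i) := fun i => eq_sub_of_add_eq' (hω.dressed_add (α i))
  have hSd : A.S (W t * pullback A.a (A.dressed (W t) (d * f))) =
      d * f - A.dressed (W t) (d * f) := eq_sub_of_add_eq' (hω.dressed_add (d * f))
  simp only [hP] at hD
  have e1 : (pullback A.a d + pullback A.b d) * W t * pullback A.a w + W t * pullback A.a w' =
      W t * pullback A.a (d * w) + pullback A.b d * (W t * pullback A.a w) +
        W t * pullback A.a w' := by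
    rw [pullback_mul]; ring
  rw [e1, map_add, map_add] at h0
  simp only [map_sub, mul_sub, map_sum, Finset.mul_sum, map_smul, mul_smul_comm, hSα, hSd,
    smul_sub, Finset.sum_sub_distrib]
  have hS' : A.S (W t * pullback A.a w) = f - w := eq_sub_of_add_eq' hS
  rw [hS'] at hD
  linear_combination hD - h0

/-- The factor `d ∘ a` from the weight cancels against `-d · w` in the evolution of the dressed
function, while `d ∘ b` is absorbed into `f'`. The finite rank terms give the products of two
potentials. -/
lemma hasDerivAt_pot {ι : Type*} [Fintype ι] {d : C(X, ℂ)} {α β : ι → C(X, ℂ)}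
    (hdeg : ∀ h, A.S (pullback A.b d * h) + d * A.S h = ∑ i, A.Φ (pullback A.b (β i) * h) • α i)
    {W : ℝ → C(Y, ℂ)} {t : ℝ} (hW : HasDerivAt W ((pullback A.a d + pullback A.b d) * W t) t)
    (hω : A.Solvable (W t)) (f f' : C(X, ℂ)) :
    HasDerivAt (fun s => A.pot (W s) f f')
      (A.pot (W t) (d * f) f' + A.pot (W t) f (d * f') -
        ∑ i, A.pot (W t) f (β i) * A.pot (W t) (α i) f') t := by
  have h1 := ((pullback A.a).restrictScalars ℝ).hasFDerivAt.comp_hasDerivAt t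
    (hasDerivAt_dressed hdeg hW hω f)
  have h2 : HasDerivAt (fun s => A.pot (W s) f f') _ t :=
    (A.Φ.restrictScalars ℝ).hasFDerivAt.comp_hasDerivAt t
      ((hW.mul h1).mul_const (pullback A.b f'))
  refine h2.congr_deriv ?_
  simp only [pot_apply, Function.comp_apply, ContinuousLinearMap.coe_restrictScalars']
  simp only [← smul_eq_mul (A.Φ _), ← map_smul, ← map_sum, ← map_add, ← map_sub]
  congr 1
  simp only [map_sub, map_sum, map_smul, pullback_mul, mul_sub, add_mul, sub_mul, Finset.mul_sum,
    Finset.sum_mul, mul_smul_comm, smul_mul_assoc]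
  ring

/-- The potential is bounded by the weight when the weight tends to zero. -/
lemma pot_isBigO {τ : Type*} {l : Filter τ} {W : τ → C(Y, ℂ)} (hW : Tendsto W l (𝓝 0))
    (f f' : C(X, ℂ)) : (fun s => A.pot (W s) f f') =O[l] W := by
  -- At weight zero the operator is the identity, so dressed functions are continuous there and stay
  -- bounded as `W` tends to zero; the explicit factor `W` gives the estimate.
  have h0 : A.Solvable 0 := by simp [Solvable]
  have h1 : Tendsto (fun s => A.dressed (W s) f) l (𝓝 (A.dressed 0 f)) :=
    (h0.contDiffAt_dressed f (m := 0)).continuousAt.tendsto.comp hW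
  have h2 : (fun s => pullback A.a (A.dressed (W s) f)) =O[l] fun _ => (1 : ℝ) :=
    (((pullback A.a).continuous.tendsto _).comp h1).isBigO_one ℝ
  have h3 : (fun s => W s * pullback A.a (A.dressed (W s) f) * pullback A.b f') =O[l]
      fun s => ‖W s‖ * 1 * (1 : ℝ) :=
    ((Asymptotics.isBigO_refl W l).norm_right.mul h2).mul
      (Asymptotics.isBigO_const_const _ one_ne_zero l)
  simp only [mul_one] at h3
  exact (A.Φ.isBigO_comp _ l).trans h3.of_norm_right

end Dressing

/-! ### The differential algebra of the elliptic entries -/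

/-- An alternating form `U` on an algebra `H` containing the coordinates `k`, `K`, `K⁻¹` of the
curve, with values in a ring with three derivations, subject to the evolution equations that belong
to the dispersion functions `k`, `K - g / K` and `k³`. -/
structure EllipticFlow (e g : ℂ) (H R : Type*) [CommRing H] [Algebra ℂ H] [CommRing R]
    [Algebra ℂ R] where
  k : H
  K : Hˣ
  curve : k * k = K + algebraMap ℂ H (3 * e) + algebraMap ℂ H g * ↑K⁻¹
  U : H →ₗ[ℂ] H →ₗ[ℂ] R
  alt : ∀ f f', U f f' = -U f' f
  D₁ : Derivation ℂ R R
  D₂ : Derivation ℂ R R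
  D₃ : Derivation ℂ R R
  flow₁ : ∀ f f', D₁ (U f f') = U (k * f) f' + U f (k * f') - (U f 1 * U K f' - U f K * U 1 f')
  flow₂ : ∀ f f', D₂ (U f f') =
    U ((K - algebraMap ℂ H g * ↑K⁻¹) * f) f' + U f ((K - algebraMap ℂ H g * ↑K⁻¹) * f') -
      (U f 1 * U (k * K) f' - U f k * U K f' + U f K * U k f' - U f (k * K) * U 1 f')
  flow₃ : ∀ f f', D₃ (U f f') = U (k ^ 3 * f) f' + U f (k ^ 3 * f') -
    (U f 1 * U (k ^ 2 * K) f' - U f K * U (k ^ 2) f' - U f k * U (k * K) f' + U f (k * K) * U k f' +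
      U f (k ^ 2) * U K f' - U f (k ^ 2 * K) * U 1 f')

namespace EllipticFlow

variable {e g : ℂ} {H R : Type*} [CommRing H] [Algebra ℂ H] [CommRing R] [Algebra ℂ R]
  (A : EllipticFlow e g H R)

/-- The symbol of an elliptic label: `K^i` for the label `2 i` and `k K^i` for `2 i + 1`. -/
def label (i : ℤ) : H := (if Odd i then A.k else 1) * ((A.K ^ (i / 2) : Hˣ) : H)

/-- The entry of `U` with the given elliptic labels. -/
def entry (i j : ℤ) : R := A.U (A.label i) (A.label j)

lemma label_zero : A.label 0 = 1 := by simp [label]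

lemma label_one : A.label 1 = A.k := by simp [label]

lemma label_two : A.label 2 = A.K := by simp [label]

lemma label_three : A.label 3 = A.k * A.K := by
  simp [label, show Odd (3 : ℤ) by decide, show (3 : ℤ) / 2 = 1 by norm_num]

lemma K_mul_label (i : ℤ) : A.K * A.label i = A.label (i + 2) := by
  have h : (i + 2) / 2 = 1 + i / 2 := by omega
  simp only [label, Int.odd_add, h, zpow_add, zpow_one, Units.val_mul, even_two, iff_true]
  ring

lemma K_inv_mul_label (i : ℤ) : ↑A.K⁻¹ * A.label i = A.label (i - 2) := by
  conv_lhs => rw [← sub_add_cancel i 2, ← K_mul_label]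
  simp

lemma k_mul_label_of_even {i : ℤ} (hi : Even i) : A.k * A.label i = A.label (i + 1) := by
  have h : (i + 1) / 2 = i / 2 := by obtain ⟨j, rfl⟩ := hi; omega
  simp [label, hi.add_one, Int.not_odd_iff_even.2 hi, h]

/-- An odd label already contains a factor `k`, and `k²` is eliminated by the curve equation. This
keeps the span of the labels closed under `k`. -/
lemma k_mul_label_of_odd {i : ℤ} (hi : Odd i) : A.k * A.label i =
    A.label (i + 1) + (3 * e) • A.label (i - 1) + g • A.label (i - 3) := by
  have h := A.k_mul_label_of_even (i := i - 1) (by grind)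
  rw [sub_add_cancel] at h
  rw [← h, ← mul_assoc, A.curve, add_mul, add_mul, K_mul_label, mul_assoc, K_inv_mul_label]
  simp only [Algebra.smul_def]
  ring_nf

lemma entry_eq (i j : ℤ) : A.entry i j = A.U (A.label i) (A.label j) := rfl

lemma entry_alt (i j : ℤ) : A.entry i j = -A.entry j i := A.alt _ _

lemma D₁_entry (i j : ℤ) : A.D₁ (A.entry i j) = A.U (A.k * A.label i) (A.label j) +
    A.U (A.label i) (A.k * A.label j) -
      (A.entry i 0 * A.entry 2 j - A.entry i 2 * A.entry 0 j) := by
  simp only [entry, flow₁, label_zero, label_two]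

lemma D₁_entry_even_even {i j : ℤ} (hi : Even i) (hj : Even j) : A.D₁ (A.entry i j) =
    A.entry (i + 1) j + A.entry i (j + 1) -
      (A.entry i 0 * A.entry 2 j - A.entry i 2 * A.entry 0 j) := by
  rw [D₁_entry, k_mul_label_of_even A hi, k_mul_label_of_even A hj]; rfl

lemma D₁_entry_odd_even {i j : ℤ} (hi : Odd i) (hj : Even j) : A.D₁ (A.entry i j) =
    A.entry (i + 1) j + (3 * e) • A.entry (i - 1) j + g • A.entry (i - 3) j + A.entry i (j + 1) -
      (A.entry i 0 * A.entry 2 j - A.entry i 2 * A.entry 0 j) := by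
  rw [D₁_entry, k_mul_label_of_odd A hi, k_mul_label_of_even A hj]
  simp only [map_add, map_smul, LinearMap.add_apply, LinearMap.smul_apply]; rfl

lemma D₁_entry_odd_odd {i j : ℤ} (hi : Odd i) (hj : Odd j) : A.D₁ (A.entry i j) =
    A.entry (i + 1) j + (3 * e) • A.entry (i - 1) j + g • A.entry (i - 3) j +
      (A.entry i (j + 1) + (3 * e) • A.entry i (j - 1) + g • A.entry i (j - 3)) -
      (A.entry i 0 * A.entry 2 j - A.entry i 2 * A.entry 0 j) := by
  rw [D₁_entry, k_mul_label_of_odd A hi, k_mul_label_of_odd A hj]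
  simp only [map_add, map_smul, LinearMap.add_apply, LinearMap.smul_apply]; rfl

lemma D₂_entry (i j : ℤ) : A.D₂ (A.entry i j) =
    A.entry (i + 2) j - g • A.entry (i - 2) j + (A.entry i (j + 2) - g • A.entry i (j - 2)) -
      (A.entry i 0 * A.entry 3 j - A.entry i 1 * A.entry 2 j + A.entry i 2 * A.entry 1 j -
        A.entry i 3 * A.entry 0 j) := by
  simp only [entry, flow₂, sub_mul, K_mul_label, ← Algebra.smul_def, smul_mul_assoc, K_inv_mul_label,
    map_sub, map_smul, LinearMap.sub_apply, LinearMap.smul_apply, label_zero, label_one, label_two,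
    label_three]

lemma k_sq_mul_label {i : ℤ} (hi : Even i) : A.k ^ 2 * A.label i =
    A.label (i + 2) + (3 * e) • A.label i + g • A.label (i - 2) := by
  rw [pow_two, mul_assoc, k_mul_label_of_even A hi, k_mul_label_of_odd A hi.add_one]
  ring_nf

lemma D₃_entry (i j : ℤ) : A.D₃ (A.entry i j) = A.U (A.k ^ 3 * A.label i) (A.label j) +
    A.U (A.label i) (A.k ^ 3 * A.label j) -
    (A.entry i 0 * (A.entry 4 j + (3 * e) • A.entry 2 j + g • A.entry 0 j) -
      A.entry i 2 * (A.entry 2 j + (3 * e) • A.entry 0 j + g • A.entry (-2) j) -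
      A.entry i 1 * A.entry 3 j + A.entry i 3 * A.entry 1 j +
      (A.entry i 2 + (3 * e) • A.entry i 0 + g • A.entry i (-2)) * A.entry 2 j -
      (A.entry i 4 + (3 * e) • A.entry i 2 + g • A.entry i 0) * A.entry 0 j) := by
  have h0 := A.k_sq_mul_label (i := 0) (by decide)
  have h2 := A.k_sq_mul_label (i := 2) (by decide)
  simp only [label_zero, mul_one, label_two, Int.reduceAdd, Int.reduceSub] at h0 h2
  simp only [entry, flow₃, h2]
  simp only [h0, map_add, map_smul, LinearMap.add_apply, LinearMap.smul_apply,
    label_zero, label_one, label_two, label_three]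

lemma k_cube_mul_label_of_even {i : ℤ} (hi : Even i) : A.k ^ 3 * A.label i =
    A.label (i + 3) + (3 * e) • A.label (i + 1) + g • A.label (i - 1) := by
  rw [pow_succ', mul_assoc, k_sq_mul_label A hi, mul_add, mul_add, mul_smul_comm, mul_smul_comm,
    k_mul_label_of_even A (by grind), k_mul_label_of_even A hi, k_mul_label_of_even A (by grind)]
  ring_nf

lemma k_cube_mul_label_of_odd {i : ℤ} (hi : Odd i) : A.k ^ 3 * A.label i =
    A.label (i + 3) + (6 * e) • A.label (i + 1) + (9 * e ^ 2 + 2 * g) • A.label (i - 1) +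
      (6 * e * g) • A.label (i - 3) + g ^ 2 • A.label (i - 5) := by
  rw [pow_succ, mul_assoc, k_mul_label_of_odd A hi, mul_add, mul_add, mul_smul_comm, mul_smul_comm,
    k_sq_mul_label A (by grind), k_sq_mul_label A (by grind), k_sq_mul_label A (by grind)]
  ring_nf
  module

/-- The side condition orients antisymmetry, so that rewriting terminates with the larger label in
front. -/
lemma entry_of_lt {i j : ℤ} (_ : i < j) : A.entry i j = -A.entry j i := A.entry_alt i j

lemma entry_self (i : ℤ) : A.entry i i = 0 := by
  have h : (2 : ℂ) • A.entry i i = 0 := by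
    rw [two_smul]
    nth_rw 2 [entry_alt]
    exact add_neg_cancel _
  simpa using h

lemma D₁_entry_even_odd {i j : ℤ} (hi : Even i) (hj : Odd j) : A.D₁ (A.entry i j) =
    A.entry (i + 1) j + (A.entry i (j + 1) + (3 * e) • A.entry i (j - 1) + g • A.entry i (j - 3)) -
      (A.entry i 0 * A.entry 2 j - A.entry i 2 * A.entry 0 j) := by
  rw [D₁_entry, k_mul_label_of_even A hi, k_mul_label_of_odd A hj]
  simp only [map_add, map_smul]; rfl

/-- The second derivatives of the logarithm of the tau function commute: `[2, 0]` is its derivative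
for the first flow, and `[3, 0] - [2, 1]` for the second. -/
lemma D₁_D₂_entry_sub_entry :
    A.D₁ (A.D₂ (A.entry 3 0 - A.entry 2 1)) = A.D₂ (A.D₂ (A.entry 2 0)) := by
  -- Both sides are expanded into polynomials in entries with the larger label first, so commutation
  -- of `D₁` and `D₂` is not assumed but comes out of the comparison.
  simp (discharger := decide) only [map_add, map_sub, map_neg, map_zero, Derivation.map_smul,
    Derivation.leibniz, smul_eq_mul, D₁_entry_odd_even, D₁_entry_even_odd, D₁_entry_even_even,
    D₁_entry_odd_odd, D₂_entry, Int.reduceAdd, Int.reduceSub, Int.reduceNeg, entry_self,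
    entry_of_lt]
  simp only [Algebra.smul_def, map_mul, map_ofNat]
  ring

/-- Four times the first equation of the system: `D₂ (A.entry 3 0 - A.entry 2 1)` stands for the
nonlocal term, and the last bracket is `g (1 - v w)`. -/
lemma D₃_entry_two_zero : 4 * A.D₃ (A.entry 2 0) = A.D₁ (A.D₁ (A.D₁ (A.entry 2 0))) +
    6 * A.D₁ (A.entry 2 0) ^ 2 + 3 * A.D₂ (A.entry 3 0 - A.entry 2 1) +
    12 * (algebraMap ℂ R g - (algebraMap ℂ R g + A.entry 3 2) * (1 - A.entry 1 0)) := by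
  rw [D₃_entry, k_cube_mul_label_of_even A (by decide), k_cube_mul_label_of_even A (by decide)]
  simp only [map_add, map_smul, LinearMap.add_apply, LinearMap.smul_apply, ← entry_eq]
  simp (discharger := decide) only [map_add, map_sub, map_neg, map_zero, Derivation.map_smul,
    Derivation.leibniz, smul_eq_mul, D₁_entry_odd_even, D₁_entry_even_odd, D₁_entry_even_even,
    D₁_entry_odd_odd, D₂_entry, Int.reduceAdd, Int.reduceSub, Int.reduceNeg, entry_self,
    entry_of_lt]
  simp only [Algebra.smul_def, map_mul, map_ofNat]
  ring

lemma D₃_entry_one_zero : 2 * A.D₃ (A.entry 1 0) = -A.D₁ (A.D₁ (A.D₁ (A.entry 1 0))) -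
    6 * (A.D₁ (A.entry 2 0) - algebraMap ℂ R (3 * e)) * A.D₁ (A.entry 1 0) -
    3 * A.D₁ (A.D₂ (A.entry 1 0)) + 6 * A.D₂ (A.entry 2 0) * (1 - A.entry 1 0) := by
  rw [D₃_entry, k_cube_mul_label_of_odd A (by decide), k_cube_mul_label_of_even A (by decide)]
  simp only [map_add, map_smul, LinearMap.add_apply, LinearMap.smul_apply, ← entry_eq]
  simp (discharger := decide) only [map_add, map_sub, map_neg, map_zero, Derivation.map_smul,
    Derivation.leibniz, smul_eq_mul, D₁_entry_odd_even, D₁_entry_even_odd, D₁_entry_even_even,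
    D₁_entry_odd_odd, D₂_entry, Int.reduceAdd, Int.reduceSub, Int.reduceNeg, entry_self,
    entry_of_lt]
  simp only [Algebra.smul_def, map_mul, map_ofNat, map_add, map_pow]
  ring

lemma D₃_entry_three_two : 2 * A.D₃ (A.entry 3 2) = -A.D₁ (A.D₁ (A.D₁ (A.entry 3 2))) -
    6 * (A.D₁ (A.entry 2 0) - algebraMap ℂ R (3 * e)) * A.D₁ (A.entry 3 2) +
    3 * A.D₁ (A.D₂ (A.entry 3 2)) + 6 * A.D₂ (A.entry 2 0) *
      (algebraMap ℂ R g + A.entry 3 2) := by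
  rw [D₃_entry, k_cube_mul_label_of_odd A (by decide), k_cube_mul_label_of_even A (by decide)]
  simp only [map_add, map_smul, LinearMap.add_apply, LinearMap.smul_apply, ← entry_eq]
  simp (discharger := decide) only [map_add, map_sub, map_neg, map_zero, Derivation.map_smul,
    Derivation.leibniz, smul_eq_mul, D₁_entry_odd_even, D₁_entry_even_odd, D₁_entry_even_even,
    D₁_entry_odd_odd, D₂_entry, Int.reduceAdd, Int.reduceSub, Int.reduceNeg, entry_self,
    entry_of_lt]
  simp only [Algebra.smul_def, map_mul, map_ofNat, map_add, map_pow]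
  ring

end EllipticFlow

/-! ### Smooth functions on an open set and their derivations -/

section SmoothFunctions

variable {P : Type*} [NormedAddCommGroup P] [NormedSpace ℝ P]

/-- The algebra of the functions that are smooth on `O`. -/
def smoothOn (O : Set P) : Subalgebra ℂ (P → ℂ) where
  carrier := {F | ContDiffOn ℝ (⊤ : ℕ∞) F O}
  mul_mem' h h' := ContDiffOn.mul h h'
  add_mem' h h' := ContDiffOn.add h h'
  algebraMap_mem' r := contDiffOn_const (c := r)

lemma mem_smoothOn {O : Set P} {F : P → ℂ} : F ∈ smoothOn O ↔ ContDiffOn ℝ (⊤ : ℕ∞) F O := Iff.rfl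

lemma smoothOn.differentiableAt {O : Set P} (hO : IsOpen O) (F : smoothOn O) {x : P} (hx : x ∈ O) :
    DifferentiableAt ℝ (F : P → ℂ) x :=
  ((mem_smoothOn.1 F.2).contDiffAt (hO.mem_nhds hx)).differentiableAt (by simp)

/-- The directional derivative on `O`, extended by zero, as a derivation of the functions that are
smooth on `O`. -/
def dirDeriv {O : Set P} (hO : IsOpen O) (v : P) : Derivation ℂ (smoothOn O) (smoothOn O) :=
  Derivation.mk'
    -- Elements of `smoothOn O` are compared on all of `P`; with the cut-off, linearity and the
    -- Leibniz rule hold trivially outside `O`.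
    { toFun := fun F => ⟨O.indicator fun x => fderiv ℝ (F : P → ℂ) x v, by
        have h : ContDiffOn ℝ (⊤ : ℕ∞) (fun x => fderiv ℝ (F : P → ℂ) x v) O :=
          ((mem_smoothOn.1 F.2).fderiv_of_isOpen hO (by simp)).clm_apply contDiffOn_const
        exact h.congr fun x hx => Set.indicator_of_mem hx _⟩
      map_add' := fun F G => by
        ext x
        by_cases hx : x ∈ O
        · have hF := smoothOn.differentiableAt hO F hx
          have hG := smoothOn.differentiableAt hO G hx
          simp [hx, fderiv_add hF hG]
        · simp [hx]
      map_smul' := fun r F => by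
        ext x
        by_cases hx : x ∈ O
        · have hF := smoothOn.differentiableAt hO F hx
          simp [hx, fderiv_const_smul hF r]
        · simp [hx] }
    fun F G => by
      ext x
      by_cases hx : x ∈ O
      · have hF := smoothOn.differentiableAt hO F hx
        have hG := smoothOn.differentiableAt hO G hx
        simp [hx, fderiv_mul hF hG]
      · simp [hx]

lemma dirDeriv_apply {O : Set P} (hO : IsOpen O) (v : P) (F : smoothOn O) :
    (dirDeriv hO v F : P → ℂ) = O.indicator fun x => fderiv ℝ (F : P → ℂ) x v := rfl

/-- A derivative at a point of the open set `O` depends only on values in `O`. Its conclusion has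
the form of its hypothesis, so it iterates to higher derivatives. -/
lemma fderiv_eqOn_dirDeriv {O : Set P} (hO : IsOpen O) (v : P) {G : P → ℂ} {F : smoothOn O}
    (h : Set.EqOn G F O) : Set.EqOn (fun x => fderiv ℝ G x v) (dirDeriv hO v F) O := fun x hx => by
  have hGF : G =ᶠ[𝓝 x] (F : P → ℂ) := Filter.eventually_of_mem (hO.mem_nhds hx) h
  simp only [dirDeriv_apply, Set.indicator_of_mem hx, hGF.fderiv_eq]

end SmoothFunctions

/-! ### The elliptic flow of a dressing problem -/

section FlowOfDressing

variable {P : Type*} [NormedAddCommGroup P] [NormedSpace ℝ P] {X Y : Type*} [TopologicalSpace X]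
  [CompactSpace X] [TopologicalSpace Y] [CompactSpace Y]

namespace Dressing

variable (A : Dressing X Y) {O : Set P} {ω : P → C(Y, ℂ)}

/-- The potential of a smooth family of solvable weights on `O`, extended by zero. -/
def potOn (hω : ContDiff ℝ (⊤ : ℕ∞) ω) (hs : ∀ x ∈ O, A.Solvable (ω x)) :
    C(X, ℂ) →ₗ[ℂ] C(X, ℂ) →ₗ[ℂ] smoothOn O :=
  LinearMap.mk₂ ℂ (fun f f' => ⟨O.indicator fun x => A.pot (ω x) f f', by
      have h : ContDiffOn ℝ (⊤ : ℕ∞) (fun x => A.pot (ω x) f f') O := fun x hx =>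
        ((((hs x hx).contDiffAt_pot f f').restrict_scalars ℝ).comp x
          hω.contDiffAt).contDiffWithinAt
      exact h.congr fun x hx => Set.indicator_of_mem hx _⟩)
    (fun f₁ f₂ f' => by ext x; by_cases hx : x ∈ O <;> simp [hx])
    (fun r f f' => by ext x; by_cases hx : x ∈ O <;> simp [hx])
    (fun f f₁ f₂ => by ext x; by_cases hx : x ∈ O <;> simp [hx])
    (fun r f f' => by ext x; by_cases hx : x ∈ O <;> simp [hx])

variable {A} {hO : IsOpen O} {hω : ContDiff ℝ (⊤ : ℕ∞) ω} {hs : ∀ x ∈ O, A.Solvable (ω x)}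

lemma potOn_apply (f f' : C(X, ℂ)) :
    (A.potOn hω hs f f' : P → ℂ) = O.indicator fun x => A.pot (ω x) f f' := rfl

lemma potOn_apply_of_mem (f f' : C(X, ℂ)) {x : P} (hx : x ∈ O) :
    (A.potOn hω hs f f' : P → ℂ) x = A.pot (ω x) f f' := by
  rw [potOn_apply, Set.indicator_of_mem hx]

lemma potOn_antisymm (hsymm : ∀ x w w', A.Φ (ω x * pullback A.a w * pullback A.b w') =
      -A.Φ (ω x * pullback A.a w' * pullback A.b w)) (f f' : C(X, ℂ)) :
    A.potOn hω hs f f' = -A.potOn hω hs f' f := by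
  ext x
  by_cases hx : x ∈ O
  · simpa [potOn_apply, hx] using (hs x hx).pot_antisymm (hsymm x) f f'
  · simp [potOn_apply, hx]

lemma dirDeriv_potOn {ι : Type*} [Fintype ι] {d : C(X, ℂ)} {α β : ι → C(X, ℂ)} {v : P}
    (hdeg : ∀ h, A.S (pullback A.b d * h) + d * A.S h = ∑ i, A.Φ (pullback A.b (β i) * h) • α i)
    (hv : ∀ x, HasDerivAt (fun t : ℝ => ω (x + t • v))
      ((pullback A.a d + pullback A.b d) * ω x) 0) (f f' : C(X, ℂ)) :
    dirDeriv hO v (A.potOn hω hs f f') = A.potOn hω hs (d * f) f' +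
      A.potOn hω hs f (d * f') -
      ∑ i, A.potOn hω hs f (β i) * A.potOn hω hs (α i) f' := by
  ext x
  by_cases hx : x ∈ O
  · have h0 : x + (0 : ℝ) • v = x := by simp
    have h1 := hasDerivAt_pot hdeg (W := fun t : ℝ => ω (x + t • v)) (t := 0)
      (by simpa using hv x) (by simpa only [h0] using hs x hx) f f'
    simp only [h0] at h1
    have h2 : DifferentiableAt ℝ (fun x => A.pot (ω x) f f') x :=
      ((((hs x hx).contDiffAt_pot f f' (m := 1)).restrict_scalars ℝ).differentiableAt
        one_ne_zero).comp x (hω.differentiable (by simp) x)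
    rw [dirDeriv_apply, Set.indicator_of_mem hx, Filter.EventuallyEq.fderiv_eq
      (f := fun x => A.pot (ω x) f f') (eventually_of_mem (hO.mem_nhds hx)
        fun z hz => potOn_apply_of_mem f f' hz)]
    rw [(h2.hasFDerivAt.hasLineDerivAt v).unique h1]
    simp [potOn_apply_of_mem, hx]
  · simp [dirDeriv_apply, potOn_apply, hx]

variable {e g : ℂ} (A)

/-- The elliptic flow of a dressing problem with the three dispersion functions. -/
def ellipticFlow (hO : IsOpen O) (hω : ContDiff ℝ (⊤ : ℕ∞) ω) (hs : ∀ x ∈ O, A.Solvable (ω x))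
    (hsymm : ∀ x w w', A.Φ (ω x * pullback A.a w * pullback A.b w') =
      -A.Φ (ω x * pullback A.a w' * pullback A.b w))
    (k : C(X, ℂ)) (K : C(X, ℂ)ˣ)
    (curve : k * k = K + algebraMap ℂ C(X, ℂ) (3 * e) + algebraMap ℂ C(X, ℂ) g * ↑K⁻¹)
    (v : Fin 3 → P)
    (hv₁ : ∀ x, HasDerivAt (fun t : ℝ => ω (x + t • v 0))
      ((pullback A.a k + pullback A.b k) * ω x) 0)
    (hv₂ : ∀ x, HasDerivAt (fun t : ℝ => ω (x + t • v 1))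
      ((pullback A.a (K - algebraMap ℂ C(X, ℂ) g * ↑K⁻¹) +
        pullback A.b (K - algebraMap ℂ C(X, ℂ) g * ↑K⁻¹)) * ω x) 0)
    (hv₃ : ∀ x, HasDerivAt (fun t : ℝ => ω (x + t • v 2))
      ((pullback A.a (k ^ 3) + pullback A.b (k ^ 3)) * ω x) 0)
    (hdeg₁ : ∀ h, A.S (pullback A.b k * h) + k * A.S h =
      ∑ i, A.Φ (pullback A.b (![1, ↑K] i) * h) • ![(K : C(X, ℂ)), -1] i)
    (hdeg₂ : ∀ h, A.S (pullback A.b (K - algebraMap ℂ C(X, ℂ) g * ↑K⁻¹) * h) +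
      (K - algebraMap ℂ C(X, ℂ) g * ↑K⁻¹) * A.S h =
      ∑ i, A.Φ (pullback A.b (![1, k, ↑K, k * K] i) * h) • ![k * K, -↑K, k, -1] i)
    (hdeg₃ : ∀ h, A.S (pullback A.b (k ^ 3) * h) + k ^ 3 * A.S h =
      ∑ i, A.Φ (pullback A.b (![1, ↑K, k, k * K, k ^ 2, k ^ 2 * K] i) * h) •
        ![k ^ 2 * K, -k ^ 2, -(k * K), k, ↑K, -1] i) :
    EllipticFlow e g C(X, ℂ) (smoothOn O) where
  k := k
  K := K
  curve := curve
  U := A.potOn hω hs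
  alt := potOn_antisymm hsymm
  D₁ := dirDeriv hO (v 0)
  D₂ := dirDeriv hO (v 1)
  D₃ := dirDeriv hO (v 2)
  flow₁ f f' := by
    rw [dirDeriv_potOn hdeg₁ hv₁]
    simp [Fin.sum_univ_succ]
    ring
  flow₂ f f' := by
    rw [dirDeriv_potOn hdeg₂ hv₂]
    simp [Fin.sum_univ_succ]
    ring
  flow₃ f f' := by
    rw [dirDeriv_potOn hdeg₃ hv₃]
    simp [Fin.sum_univ_succ]
    ring

end Dressing

end FlowOfDressing

/-! ### Decay and integration along half lines -/

lemma integral_Iic_of_hasDerivAt_of_isBigO_exp {f f' : ℝ → ℂ} {a δ : ℝ} (hδ : 0 < δ)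
    (hderiv : ∀ s ≤ a, HasDerivAt f (f' s) s) (hcont : ContinuousOn f' (Set.Iic a))
    (hf : f =O[atBot] fun s => Real.exp (δ * s)) (hf' : f' =O[atBot] fun s => Real.exp (δ * s)) :
    IntegrableOn f' (Set.Iic a) ∧ f a = ∫ s in Set.Iic a, f' s := by
  have hint : IntegrableOn f' (Set.Iic a) :=
    (hcont.locallyIntegrableOn measurableSet_Iic).integrableOn_of_isBigO_atBot hf'
      ⟨Set.Iic a, Iic_mem_atBot a, integrableOn_exp_mul_Iic hδ a⟩
  have hlim : Tendsto f atBot (𝓝 0) :=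
    hf.trans_tendsto (Real.tendsto_exp_atBot.comp (tendsto_id.const_mul_atBot hδ))
  refine ⟨hint, ?_⟩
  rw [integral_Iic_of_hasDerivAt_of_tendsto (hderiv a le_rfl).continuousAt.continuousWithinAt
    (fun s hs => hderiv s (le_of_lt hs)) hint hlim, sub_zero]

lemma integral_Ici_of_hasDerivAt_of_isBigO_exp {f f' : ℝ → ℂ} {a δ : ℝ} (hδ : 0 < δ)
    (hderiv : ∀ s ≥ a, HasDerivAt f (f' s) s) (hcont : ContinuousOn f' (Set.Ici a))
    (hf : f =O[atTop] fun s => Real.exp (-δ * s)) (hf' : f' =O[atTop] fun s => Real.exp (-δ * s)) :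
    IntegrableOn f' (Set.Ici a) ∧ f a = -∫ s in Set.Ici a, f' s := by
  have hint : IntegrableOn f' (Set.Ici a) :=
    (hcont.locallyIntegrableOn measurableSet_Ici).integrableOn_of_isBigO_atTop hf'
      ⟨Set.Ioi a, Ioi_mem_atTop a, integrableOn_exp_mul_Ioi (neg_lt_zero.2 hδ) a⟩
  have hlim : Tendsto f atTop (𝓝 0) :=
    hf.trans_tendsto (Real.tendsto_exp_atBot.comp
      (tendsto_id.const_mul_atTop_of_neg (neg_lt_zero.2 hδ)))
  refine ⟨hint, ?_⟩
  rw [integral_Ici_eq_integral_Ioi, integral_Ioi_of_hasDerivAt_of_tendsto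
    (hderiv a le_rfl).continuousAt.continuousWithinAt (fun s hs => hderiv s (le_of_lt hs))
    (hint.mono_set Set.Ioi_subset_Ici_self) hlim, zero_sub, neg_neg]

/-! ### Polynomials in the potentials without constant term, and the system for smooth entries -/

namespace EllipticFlow

section PotentialAlgebra

variable {e g : ℂ} {H R : Type*} [CommRing H] [Algebra ℂ H] [CommRing R] [Algebra ℂ R]
  (A : EllipticFlow e g H R)

/-- The algebra without unit that is generated by the values of `U`. -/
def potentialAlgebra : NonUnitalSubalgebra ℂ R :=
  NonUnitalAlgebra.adjoin ℂ {F | ∃ f f', A.U f f' = F}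

lemma U_mem (f f' : H) : A.U f f' ∈ A.potentialAlgebra :=
  NonUnitalAlgebra.subset_adjoin ℂ ⟨f, f', rfl⟩

lemma derivation_mem {D : Derivation ℂ R R} (hD : ∀ f f', D (A.U f f') ∈ A.potentialAlgebra)
    {F : R} (hF : F ∈ A.potentialAlgebra) : D F ∈ A.potentialAlgebra := by
  induction hF using NonUnitalAlgebra.adjoin_induction with
  | mem x hx => obtain ⟨f, f', rfl⟩ := hx; exact hD f f'
  | add x y _ _ hx hy => rw [map_add]; exact add_mem hx hy
  | zero => rw [map_zero]; exact zero_mem _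
  | mul x y hx' hy' hx hy =>
    rw [Derivation.leibniz]
    exact add_mem (mul_mem hx' hy) (mul_mem hy' hx)
  | smul r x _ hx => rw [Derivation.map_smul]; exact SMulMemClass.smul_mem r hx

lemma D₂_mem {F : R} (hF : F ∈ A.potentialAlgebra) : A.D₂ F ∈ A.potentialAlgebra := by
  refine A.derivation_mem (fun f f' => ?_) hF
  rw [flow₂]
  have h := A.U_mem
  exact sub_mem (add_mem (h _ _) (h _ _)) (sub_mem (add_mem (sub_mem (mul_mem (h _ _) (h _ _))
    (mul_mem (h _ _) (h _ _))) (mul_mem (h _ _) (h _ _))) (mul_mem (h _ _) (h _ _)))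

end PotentialAlgebra

section SmoothValues

variable {P : Type*} [NormedAddCommGroup P] [NormedSpace ℝ P] {O : Set P} {e g : ℂ} {H : Type*}
  [CommRing H] [Algebra ℂ H]

/-- Decay of the generators passes to the whole algebra because it has no constants; in a product
one factor is merely bounded, as `φ` tends to zero. -/
lemma isBigO_of_mem (A : EllipticFlow e g H (smoothOn O)) {τ : Type*} {l : Filter τ} {γ : τ → P}
    {φ : τ → ℝ} (hφ : Tendsto φ l (𝓝 0))
    (hU : ∀ f f', (fun s => (A.U f f' : P → ℂ) (γ s)) =O[l] φ) {F : smoothOn O}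
    (hF : F ∈ A.potentialAlgebra) : (fun s => (F : P → ℂ) (γ s)) =O[l] φ := by
  induction hF using NonUnitalAlgebra.adjoin_induction with
  | mem x hx => obtain ⟨f, f', rfl⟩ := hx; exact hU f f'
  | add x y _ _ hx hy => exact hx.add hy
  | zero => exact Asymptotics.isBigO_zero _ _
  | mul x y _ _ hx hy => simpa using hx.mul (hy.trans (hφ.isBigO_one ℝ))
  | smul r x _ hx => exact hx.const_mul_left r

variable {O : Set (Fin 3 → ℝ)} (hO : IsOpen O) (A : EllipticFlow e g H (smoothOn O))

lemma pd_one_eqOn (hD₁ : A.D₁ = dirDeriv hO (Pi.single 0 1))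
    {G : (Fin 3 → ℝ) → ℂ} {F : smoothOn O} (h : Set.EqOn G F O) :
    Set.EqOn (pd 1 G) (A.D₁ F) O := by
  rw [hD₁]; exact fderiv_eqOn_dirDeriv hO _ h

lemma pd_two_eqOn (hD₂ : A.D₂ = dirDeriv hO (Pi.single 1 1))
    {G : (Fin 3 → ℝ) → ℂ} {F : smoothOn O} (h : Set.EqOn G F O) :
    Set.EqOn (pd 2 G) (A.D₂ F) O := by
  rw [hD₂]; exact fderiv_eqOn_dirDeriv hO _ h

lemma pd_three_eqOn (hD₃ : A.D₃ = dirDeriv hO (Pi.single 2 1))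
    {G : (Fin 3 → ℝ) → ℂ} {F : smoothOn O} (h : Set.EqOn G F O) :
    Set.EqOn (pd 3 G) (A.D₃ F) O := by
  rw [hD₃]; exact fderiv_eqOn_dirDeriv hO _ h

/-- The elliptic coupled KP system for the elliptic entries of an elliptic flow. -/
lemma solvesEllCoupledKP (hD₁ : A.D₁ = dirDeriv hO (Pi.single 0 1))
    (hD₂ : A.D₂ = dirDeriv hO (Pi.single 1 1)) (hD₃ : A.D₃ = dirDeriv hO (Pi.single 2 1))
    (hg : g ≠ 0) {u v w : (Fin 3 → ℝ) → ℂ}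
    (hu : Set.EqOn u (A.entry 2 0) O)
    (hv : Set.EqOn v (1 + g⁻¹ • A.entry 3 2 : smoothOn O) O)
    (hw : Set.EqOn w (1 - A.entry 1 0 : smoothOn O) O) :
    SolvesEllCoupledKP e g O u v w (A.D₂ (A.entry 3 0 - A.entry 2 1) : smoothOn O) := by
  intro x hx
  have p₁ := fun {G : (Fin 3 → ℝ) → ℂ} {F : smoothOn O} => A.pd_one_eqOn hO hD₁ (G := G) (F := F)
  have p₂ := fun {G : (Fin 3 → ℝ) → ℂ} {F : smoothOn O} => A.pd_two_eqOn hO hD₂ (G := G) (F := F)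
  have p₃ := fun {G : (Fin 3 → ℝ) → ℂ} {F : smoothOn O} => A.pd_three_eqOn hO hD₃ (G := G) (F := F)
  rw [p₃ hu hx, p₁ (p₁ (p₁ hu)) hx, p₁ hu hx, p₂ hu hx, p₃ hv hx, p₁ (p₁ (p₁ hv)) hx, p₁ hv hx,
    p₁ (p₂ hv) hx, p₃ hw hx, p₁ (p₁ (p₁ hw)) hx, p₁ hw hx, p₁ (p₂ hw) hx, hv hx, hw hx]
  have hn : ∀ m : ℕ, [m.AtLeastTwo] → ((ofNat(m) : smoothOn O) : (Fin 3 → ℝ) → ℂ) x = ofNat(m) :=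
    fun _ _ => rfl
  have E₁ := congr($(A.D₃_entry_two_zero).1 x)
  have E₂ := congr($(A.D₃_entry_three_two).1 x)
  have E₃ := congr($(A.D₃_entry_one_zero).1 x)
  simp only [map_add, map_sub, map_neg, Derivation.map_smul, Derivation.map_one_eq_zero, zero_add,
    zero_sub] at E₁ E₂ E₃ ⊢
  simp only [hn, Subalgebra.coe_add, Subalgebra.coe_mul, Subalgebra.coe_sub, Subalgebra.coe_neg,
    Subalgebra.coe_pow, Subalgebra.coe_one, Subalgebra.coe_smul, Subalgebra.coe_algebraMap,
    Pi.add_apply, Pi.mul_apply, Pi.sub_apply, Pi.neg_apply, Pi.pow_apply, Pi.one_apply,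
    Pi.smul_apply, Pi.algebraMap_apply, smul_eq_mul, Algebra.algebraMap_self, RingHom.id_apply]
    at E₁ E₂ E₃ ⊢
  -- The definition `v = 1 + g⁻¹ U^[3,2]` leaves products `g g⁻¹` in the first two equations; the
  -- multiples of `hgg` remove them.
  have hgg := mul_inv_cancel₀ hg
  refine ⟨?_, ?_, ?_⟩
  · linear_combination E₁ / 4 + 3 * (A.entry 3 2).1 x * (1 - (A.entry 1 0).1 x) * hgg
  · linear_combination g⁻¹ * E₂ / 2 + 3 * (A.D₂ (A.entry 2 0)).1 x * hgg
  · linear_combination -E₃ / 2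

end SmoothValues

end EllipticFlow

/-! ### Functions on the curve -/

namespace Curve

variable (E : Curve)

lemma g_ne_zero : E.g ≠ 0 := mul_ne_zero (sub_ne_zero.2 E.ne₁₂) (sub_ne_zero.2 E.ne₁₃)

lemma sqrtg_ne_zero : E.sqrtg ≠ 0 := fun h => E.g_ne_zero <| by
  rw [g, ← E.sqrtg_sq, h]; simp

lemma K_ne_zero (κ : E.Pt) : E.K κ ≠ 0 := sub_ne_zero.2 κ.2.2

/-- The second difference of `branch` at `0, ±1` isolates the coefficient of `Z²`, which is absent
on the left. -/
lemma e_add_e_add_e : E.e₁ + E.e₂ + E.e₃ = 0 := by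
  linear_combination (E.branch 1 + E.branch (-1) - 2 * E.branch 0) / 8

/-- The factored Weierstrass equation divided by `4 K²`. The middle coefficient `2e₁ - e₂ - e₃` is
`3e` because the branch points sum to zero. -/
lemma k_sq (κ : E.Pt) : E.k κ ^ 2 = E.K κ + 3 * E.e + E.g / E.K κ := by
  have h := E.P.derivWeierstrassP_sq κ κ.2.1
  rw [E.branch] at h
  have hK := E.K_ne_zero κ
  have hP : E.P.weierstrassP κ = E.K κ + E.e := by simp [K]
  have hk : E.k κ = E.P.derivWeierstrassP κ / (2 * E.K κ) := by
    change 1 / 2 * (_ / E.K κ) = _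
    ring
  rw [hk, div_pow, h, hP, g, e]
  field_simp
  linear_combination (-(E.K κ ^ 2 * 4) : ℂ) * E.e_add_e_add_e

@[fun_prop]
lemma continuous_K : Continuous E.K := by
  have h := E.P.differentiableOn_weierstrassP.continuousOn
  exact (h.comp_continuous continuous_subtype_val fun κ => κ.2.1).sub continuous_const

@[fun_prop]
lemma continuous_k : Continuous E.k := by
  have h := E.P.differentiableOn_derivWeierstrassP.continuousOn
  exact continuous_const.mul ((h.comp_continuous continuous_subtype_val fun κ => κ.2.1).div
    E.continuous_K E.K_ne_zero)

lemma kernel_antisymm (κ κ' : E.Pt) : E.kernel κ κ' = -E.kernel κ' κ := by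
  simp only [kernel, add_comm (E.k κ'), mul_comm (E.K κ')]
  split_ifs <;> ring

lemma measurable_kernel : Measurable fun z : E.Pt × E.Pt => E.kernel z.1 z.2 := by
  have hk := E.continuous_k.measurable
  have hK := E.continuous_K.measurable
  unfold kernel
  refine Measurable.ite ?_ (by fun_prop) (by fun_prop)
  exact ((measurableSet_singleton (0 : ℂ)).compl).preimage (by fun_prop : Measurable
    fun z : E.Pt × E.Pt => E.k z.1 + E.k z.2)

variable {E} in
-- Subtracting the curve equations at the two points gives `(k + k')(k - k') = (K - K')(1 -
-- g/(KK'))`. Away from singularities one denominator is nonzero, and this identity transfers the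
-- relation from one quotient to the other.
lemma mul_kernel_of_not_kernelSingular {κ κ' : E.Pt} (h : ¬ E.KernelSingular κ κ') :
    (E.k κ + E.k κ') * E.kernel κ κ' = E.K κ - E.K κ' ∧
      (1 - E.g / (E.K κ * E.K κ')) * E.kernel κ κ' = E.k κ - E.k κ' := by
  have hK := E.K_ne_zero κ
  have hK' := E.K_ne_zero κ'
  have key : (E.k κ + E.k κ') * (E.k κ - E.k κ') =
      (E.K κ - E.K κ') * (1 - E.g / (E.K κ * E.K κ')) := by
    have h1 : E.g / E.K κ - E.g / E.K κ' = -(E.K κ - E.K κ') * (E.g / (E.K κ * E.K κ')) := by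
      field_simp; ring
    linear_combination E.k_sq κ - E.k_sq κ' + h1
  by_cases hk : E.k κ + E.k κ' = 0
  · have hg : 1 - E.g / (E.K κ * E.K κ') ≠ 0 := fun h0 => h ⟨hk, by
      rw [sub_eq_zero, eq_div_iff (mul_ne_zero hK hK'), one_mul] at h0
      exact h0⟩
    simp only [kernel, hk, ne_eq, not_true_eq_false, if_false]
    rw [hk, zero_mul] at key
    refine ⟨?_, mul_div_cancel₀ _ hg⟩
    rw [zero_mul]
    exact ((mul_eq_zero.1 key.symm).resolve_right hg).symm
  · simp only [kernel, ne_eq, hk, not_false_eq_true, if_true]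
    refine ⟨mul_div_cancel₀ _ hk, ?_⟩
    rw [mul_div_assoc', div_eq_iff hk]
    linear_combination -key

lemma disp_one (κ : E.Pt) : E.disp 1 κ = E.k κ := by simp [disp]

lemma disp_two (κ : E.Pt) : E.disp 2 κ = E.K κ - E.g / E.K κ := by
  simp [disp, show ¬ Odd 2 by decide]

lemma disp_three (κ : E.Pt) : E.disp 3 κ = E.k κ ^ 3 := by
  simp [disp, show Odd 3 by decide]

@[fun_prop]
lemma continuous_disp (j : ℕ) : Continuous (E.disp j) := by
  unfold disp
  split_ifs
  · fun_prop
  · exact (E.continuous_K.pow _).sub ((continuous_const.div E.continuous_K E.K_ne_zero).pow _)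

lemma continuous_planeWave (n : ℤ) (y : ℕ →₀ ℝ) (x : Fin 3 → ℝ) :
    Continuous (E.planeWave n y x) := by
  unfold planeWave Finsupp.sum
  refine Continuous.mul (by fun_prop) ?_
  exact (E.continuous_K.div_const _).zpow₀ n fun κ =>
    Or.inl (div_ne_zero (E.K_ne_zero κ) E.sqrtg_ne_zero)

lemma planeWave_ne_zero (n : ℤ) (y : ℕ →₀ ℝ) (x : Fin 3 → ℝ) (κ : E.Pt) :
    E.planeWave n y x κ ≠ 0 :=
  mul_ne_zero (Complex.exp_ne_zero _)
    (zpow_ne_zero _ (div_ne_zero (E.K_ne_zero κ) E.sqrtg_ne_zero))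

lemma planeWave_add (n : ℤ) (y : ℕ →₀ ℝ) (x x' : Fin 3 → ℝ) (κ : E.Pt) :
    E.planeWave n y (x + x') κ =
      Complex.exp (∑ i : Fin 3, E.disp ((i : ℕ) + 1) κ * (x' i : ℂ)) * E.planeWave n y x κ := by
  simp only [planeWave]
  rw [← mul_assoc, ← Complex.exp_add]
  congr 2
  simp only [Pi.add_apply, Complex.ofReal_add, mul_add, Finset.sum_add_distrib]
  ring

end Curve

/-! ### The plane wave factor as a smooth function of the times -/

lemma continuousMap_exp_apply {X : Type*} [TopologicalSpace X] [CompactSpace X] (f : C(X, ℂ))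
    (x : X) : NormedSpace.exp f x = Complex.exp (f x) := by
  rw [Complex.exp_eq_exp_ℂ]
  exact NormedSpace.map_exp (ContinuousMap.evalAlgHom ℂ ℂ x) (continuous_eval_const x) f

namespace Curve.SpectralMeasure

variable {E : Curve} (ζ : E.SpectralMeasure)

/-! ### The dressing problem of a spectral measure -/

instance : CompactSpace ζ.D := isCompact_iff_compactSpace.1 ζ.compact

instance : CompactSpace ζ.spec := isCompact_iff_compactSpace.1 (ζ.compact.image continuous_fst)

lemma measurableSet_D : MeasurableSet ζ.D := ζ.compact.measurableSet

/-- The projection of the domain to the first factor. -/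
def left : C(ζ.D, ζ.spec) := ⟨fun p => ⟨p.1.1, p.1, p.2, rfl⟩, by fun_prop⟩

/-- The projection of the domain to the second factor. -/
def right : C(ζ.D, ζ.spec) := ⟨fun p => ⟨p.1.2, p.1.swap, ζ.swap_mem _ p.2, rfl⟩, by fun_prop⟩

@[simp] lemma coe_left (p : ζ.D) : (ζ.left p : E.Pt) = p.1.1 := rfl

@[simp] lemma coe_right (p : ζ.D) : (ζ.right p : E.Pt) = p.1.2 := rfl

/-- The measure on the domain. -/
def meas : Measure ζ.D := ζ.μ.comap Subtype.val

lemma map_meas : ζ.meas.map Subtype.val = ζ.μ.restrict ζ.D :=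
  map_comap_subtype_coe ζ.measurableSet_D ζ.μ

instance : IsFiniteMeasure ζ.meas := by
  have := ζ.finite
  have h : IsFiniteMeasure (ζ.meas.map Subtype.val) := by rw [map_meas]; infer_instance
  exact Measure.isFiniteMeasure_of_map measurable_subtype_coe.aemeasurable

lemma integral_meas (F : E.Pt × E.Pt → ℂ) : ∫ p, F p ∂ζ.meas = ∫ p in ζ.D, F p ∂ζ.μ :=
  integral_subtype_comap ζ.measurableSet_D F

lemma integrable_meas {F : E.Pt × E.Pt → ℂ} (hF : IntegrableOn F ζ.D ζ.μ) :
    Integrable (fun p : ζ.D => F p) ζ.meas := by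
  rw [IntegrableOn, ← map_meas] at hF
  exact hF.comp_measurable measurable_subtype_coe

lemma ae_meas {q : E.Pt × E.Pt → Prop} (h : ∀ᵐ p ∂ζ.μ.restrict ζ.D, q p) :
    ∀ᵐ p ∂ζ.meas, q p.1 := by
  rw [← map_meas] at h
  exact ae_of_ae_map measurable_subtype_coe.aemeasurable h

lemma integral_swap (F : E.Pt × E.Pt → ℂ) :
    ∫ p, F p.1.swap ∂ζ.meas = ∫ p, F p ∂ζ.meas := by
  rw [integral_meas, integral_meas ζ fun p => F p.swap]
  exact ζ.swap_measure.integral_comp MeasurableEquiv.prodComm.measurableEmbedding F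

lemma integrable_kernel (x : ζ.spec) :
    Integrable (fun p : ζ.D => ζ.dens p * E.kernel x (ζ.right p)) ζ.meas :=
  ζ.integrable_meas (ζ.kernel_integrable x x.2)

lemma tendsto_kernel (x₀ : ζ.spec) :
    Tendsto (fun x : ζ.spec => ∫ p : ζ.D, ‖ζ.dens p * E.kernel x (ζ.right p) -
      ζ.dens p * E.kernel x₀ (ζ.right p)‖ ∂ζ.meas) (𝓝 x₀) (𝓝 0) := by
  have hv : Tendsto (fun x : ζ.spec => (x : E.Pt)) (𝓝 x₀) (𝓝[Prod.fst '' ζ.D] x₀) :=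
    tendsto_nhdsWithin_iff.2 ⟨continuous_subtype_val.continuousAt, Eventually.of_forall fun x => x.2⟩
  have h := (ζ.kernel_continuous x₀ x₀.2).comp hv
  refine h.congr fun x => ?_
  exact (integral_subtype_comap ζ.measurableSet_D fun p => ‖ζ.dens p * E.kernel x p.2 -
    ζ.dens p * E.kernel x₀ p.2‖).symm

/-- The dressing problem of a spectral measure, given by its Cauchy kernel. -/
def dressing : Dressing ζ.spec ζ.D where
  a := ζ.left
  b := ζ.right
  S := familyOp (integralFamily _ ζ.integrable_kernel ζ.tendsto_kernel)
  Φ := integralFunctional _ (ζ.integrable_meas ζ.integrable)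
  antisymm h h' := by
    obtain ⟨M, hM⟩ := exists_integral_norm_le _ ζ.integrable_kernel ζ.tendsto_kernel
    refine integral_kernel_antisymm (b := ζ.right) (Ω := fun x x' => E.kernel x x')
      (ζ.integrable_meas ζ.integrable) ?_ (fun x x' => E.kernel_antisymm x x')
      ζ.integrable_kernel hM h h'
    have hm : Measurable fun z : ζ.D × ζ.D => ((z.1.1.2, z.2.1.2) : E.Pt × E.Pt) := by fun_prop
    exact (E.measurable_kernel.comp hm).aestronglyMeasurable

lemma dressing_S_apply (h : C(ζ.D, ℂ)) (x : ζ.spec) :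
    ζ.dressing.S h x = ∫ p, ζ.dens p.1 * E.kernel x p.1.2 * h p ∂ζ.meas := rfl

lemma dressing_Φ_apply (h : C(ζ.D, ℂ)) :
    ζ.dressing.Φ h = ∫ p, ζ.dens p.1 * h p ∂ζ.meas := rfl

lemma isCompactOperator_weighted (ω : C(ζ.D, ℂ)) :
    IsCompactOperator (ζ.dressing.weighted ω) := by
  have h : IsCompactOperator ζ.dressing.S := isCompactOperator_familyOp _
  exact h.comp_clm ((ContinuousLinearMap.mul ℂ C(ζ.D, ℂ) ω).comp (pullback ζ.left))

/-- The weight `r(κ) r(κ')` of a function `r` on the spectral set. -/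
def weight (r : C(ζ.spec, ℂ)) : C(ζ.D, ℂ) := pullback ζ.left r * pullback ζ.right r

/-- The measure is invariant under the swap, the weight `r(κ) r(κ')` is symmetric, and the density
changes sign. -/
lemma dressing_Φ_weight (r w w' : C(ζ.spec, ℂ)) :
    ζ.dressing.Φ (ζ.weight r * pullback ζ.left w * pullback ζ.right w') =
      -ζ.dressing.Φ (ζ.weight r * pullback ζ.left w' * pullback ζ.right w) := by
  classical
  let F : E.Pt × E.Pt → ℂ := fun q => if hq : q ∈ ζ.D then ζ.dens q *
    (ζ.weight r * pullback ζ.left w * pullback ζ.right w') ⟨q, hq⟩ else 0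
  have h1 : ζ.dressing.Φ (ζ.weight r * pullback ζ.left w * pullback ζ.right w') =
      ∫ p, F p.1 ∂ζ.meas := by
    rw [dressing_Φ_apply]
    congr 1; ext p
    simp [F]
  rw [h1, ← integral_swap, dressing_Φ_apply, ← integral_neg]
  congr 1; ext p
  have hl : ζ.left ⟨p.1.swap, ζ.swap_mem _ p.2⟩ = ζ.right p := rfl
  have hr : ζ.right ⟨p.1.swap, ζ.swap_mem _ p.2⟩ = ζ.left p := rfl
  simp only [F, ζ.swap_mem _ p.2, dif_pos, ζ.antisymm _ p.2, weight, ContinuousMap.mul_apply,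
    pullback_apply, hl, hr]
  ring

/-! ### The coordinates and the flows on the spectral set -/

/-- The coordinate `k` on the spectral set. -/
def kMap : C(ζ.spec, ℂ) := ⟨fun x => E.k x, E.continuous_k.comp continuous_subtype_val⟩

/-- The coordinate `K` on the spectral set, as an invertible function. -/
def KMap : C(ζ.spec, ℂ)ˣ where
  val := ⟨fun x => E.K x, E.continuous_K.comp continuous_subtype_val⟩
  inv := ⟨fun x => (E.K x)⁻¹, (E.continuous_K.comp continuous_subtype_val).inv₀
    fun x => E.K_ne_zero x⟩
  val_inv := by ext x; exact mul_inv_cancel₀ (E.K_ne_zero x)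
  inv_val := by ext x; exact inv_mul_cancel₀ (E.K_ne_zero x)

@[simp] lemma kMap_apply (x : ζ.spec) : ζ.kMap x = E.k x := rfl

@[simp] lemma KMap_apply (x : ζ.spec) : (ζ.KMap : C(ζ.spec, ℂ)) x = E.K x := rfl

@[simp] lemma KMap_inv_apply (x : ζ.spec) : (↑ζ.KMap⁻¹ : C(ζ.spec, ℂ)) x = (E.K x)⁻¹ := rfl

lemma kMap_mul_kMap : ζ.kMap * ζ.kMap = ζ.KMap + algebraMap ℂ C(ζ.spec, ℂ) (3 * E.e) +
    algebraMap ℂ C(ζ.spec, ℂ) E.g * ↑ζ.KMap⁻¹ := by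
  ext x
  have h := E.k_sq x
  simpa [pow_two, div_eq_mul_inv] using h

/-- The finite rank relation is needed only off the singular pairs, which `kernel_regular` makes
negligible. -/
lemma dressing_degenerate {ι : Type*} [Fintype ι] {d : C(ζ.spec, ℂ)} {α β : ι → C(ζ.spec, ℂ)}
    (hd : ∀ x x' : ζ.spec, ¬ E.KernelSingular x x' →
      (d x + d x') * E.kernel x x' = ∑ i, α i x * β i x') (h : C(ζ.D, ℂ)) :
    ζ.dressing.S (pullback ζ.right d * h) + d * ζ.dressing.S h =
      ∑ i, ζ.dressing.Φ (pullback ζ.right (β i) * h) • α i := by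
  ext x
  have := integral_kernel_degenerate (b := ζ.right) (Ω := fun x x' => E.kernel x x')
    (ζ.integrable_meas ζ.integrable) ζ.integrable_kernel (d := d) (α := α) (β := β)
    (fun x => (ζ.ae_meas (ζ.kernel_regular x x.2)).mono fun p hp => hd x (ζ.right p) hp) h x
  simp only [ContinuousMap.add_apply, ContinuousMap.mul_apply, ContinuousMap.sum_apply,
    ContinuousMap.smul_apply, smul_eq_mul]
  exact this

lemma dressing_degenerate₁ (h : C(ζ.D, ℂ)) :
    ζ.dressing.S (pullback ζ.right ζ.kMap * h) + ζ.kMap * ζ.dressing.S h =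
      ∑ i, ζ.dressing.Φ (pullback ζ.right (![1, ↑ζ.KMap] i) * h) •
        ![(ζ.KMap : C(ζ.spec, ℂ)), -1] i := by
  refine ζ.dressing_degenerate (fun x x' hx => ?_) h
  obtain ⟨h1, -⟩ := mul_kernel_of_not_kernelSingular hx
  simp [Fin.sum_univ_succ, h1, sub_eq_add_neg]

lemma dressing_degenerate₂ (h : C(ζ.D, ℂ)) :
    ζ.dressing.S (pullback ζ.right (ζ.KMap - algebraMap ℂ C(ζ.spec, ℂ) E.g * ↑ζ.KMap⁻¹) * h) +
      (ζ.KMap - algebraMap ℂ C(ζ.spec, ℂ) E.g * ↑ζ.KMap⁻¹) * ζ.dressing.S h =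
      ∑ i, ζ.dressing.Φ (pullback ζ.right (![1, ζ.kMap, ↑ζ.KMap, ζ.kMap * ζ.KMap] i) * h) •
        ![ζ.kMap * ζ.KMap, -↑ζ.KMap, ζ.kMap, -1] i := by
  refine ζ.dressing_degenerate (fun x x' hx => ?_) h
  obtain ⟨-, h2⟩ := mul_kernel_of_not_kernelSingular hx
  have hK := E.K_ne_zero x
  have hK' := E.K_ne_zero x'
  -- The sum of the second dispersions contains the factor `1 - g/(KK')`, so multiplying by the
  -- kernel gives `(K + K')(k - k')`, the four rank one terms.
  have h3 : E.K x - E.g * (E.K x)⁻¹ + (E.K x' - E.g * (E.K x')⁻¹) =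
      (E.K x + E.K x') * (1 - E.g / (E.K x * E.K x')) := by field_simp; ring
  simp [Fin.sum_univ_succ]
  linear_combination (E.K x + E.K x') * h2 + E.kernel x x' * h3

lemma dressing_degenerate₃ (h : C(ζ.D, ℂ)) :
    ζ.dressing.S (pullback ζ.right (ζ.kMap ^ 3) * h) + ζ.kMap ^ 3 * ζ.dressing.S h =
      ∑ i, ζ.dressing.Φ (pullback ζ.right (![1, ↑ζ.KMap, ζ.kMap, ζ.kMap * ζ.KMap, ζ.kMap ^ 2,
        ζ.kMap ^ 2 * ζ.KMap] i) * h) •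
        ![ζ.kMap ^ 2 * ζ.KMap, -ζ.kMap ^ 2, -(ζ.kMap * ζ.KMap), ζ.kMap, ↑ζ.KMap, -1] i := by
  refine ζ.dressing_degenerate (fun x x' hx => ?_) h
  obtain ⟨h1, -⟩ := mul_kernel_of_not_kernelSingular hx
  simp [Fin.sum_univ_succ]
  -- `k³ + k'³ = (k + k')(k² - kk' + k'²)`, so the third relation is a multiple of the first.
  linear_combination (E.k x ^ 2 - E.k x * E.k x' + E.k x' ^ 2) * h1

/-- The dispersion of the time with index `i`, on the spectral set. -/
def dispMap (i : Fin 3) : C(ζ.spec, ℂ) :=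
  ⟨fun x => E.disp (i + 1) x, (E.continuous_disp _).comp continuous_subtype_val⟩

lemma dispMap_zero : ζ.dispMap 0 = ζ.kMap := by ext x; exact E.disp_one x

lemma dispMap_one : ζ.dispMap 1 = ζ.KMap - algebraMap ℂ C(ζ.spec, ℂ) E.g * ↑ζ.KMap⁻¹ := by
  ext x
  refine (E.disp_two x).trans ?_
  simp [div_eq_mul_inv]

lemma dispMap_two : ζ.dispMap 2 = ζ.kMap ^ 3 := by ext x; exact E.disp_three x

variable (n : ℤ) (y : ℕ →₀ ℝ)

/-- The plane wave factor on the spectral set. -/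
def waveMap (x : Fin 3 → ℝ) : C(ζ.spec, ℂ) :=
  ⟨fun κ => E.planeWave n y x κ, (E.continuous_planeWave n y x).comp continuous_subtype_val⟩

lemma waveMap_add (x x' : Fin 3 → ℝ) : ζ.waveMap n y (x + x') =
    NormedSpace.exp (∑ i, x' i • ζ.dispMap i) * ζ.waveMap n y x := by
  ext κ
  rw [ContinuousMap.mul_apply, continuousMap_exp_apply]
  change E.planeWave n y (x + x') κ = _ * E.planeWave n y x κ
  rw [E.planeWave_add]
  congr 2
  simp only [ContinuousMap.sum_apply]
  exact Finset.sum_congr rfl fun i _ => by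
    rw [mul_comm]; exact (Complex.real_smul (x := x' i) (z := E.disp (i + 1) κ)).symm

/-- In the Banach algebra of continuous functions the wave factor is the exponential of a linear
function of the times, so it is smooth for the sup norm. -/
lemma contDiff_waveMap : ContDiff ℝ (⊤ : ℕ∞) (ζ.waveMap n y) := by
  have h : ζ.waveMap n y = fun x =>
      NormedSpace.exp (∑ i, x i • ζ.dispMap i) * ζ.waveMap n y 0 := by
    ext1 x; simpa using ζ.waveMap_add n y 0 x
  rw [h]
  have h1 : ContDiff ℝ (⊤ : ℕ∞) fun x : Fin 3 → ℝ => ∑ i, x i • ζ.dispMap i := by fun_prop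
  have h2 : ContDiff ℝ (⊤ : ℕ∞) (NormedSpace.exp : C(ζ.spec, ℂ) → C(ζ.spec, ℂ)) :=
    contDiff_iff_contDiffAt.2 fun f => (NormedSpace.exp_analytic (𝕂 := ℝ) f).contDiffAt
  exact (h2.comp h1).mul contDiff_const

lemma waveMap_add_smul_single (x : Fin 3 → ℝ) (i : Fin 3) (t : ℝ) :
    ζ.waveMap n y (x + t • Pi.single i 1) =
      NormedSpace.exp (t • ζ.dispMap i) * ζ.waveMap n y x := by
  rw [waveMap_add]
  congr 2
  rw [Finset.sum_eq_single i] <;> simp +contextual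

lemma hasDerivAt_waveMap (x : Fin 3 → ℝ) (i : Fin 3) :
    HasDerivAt (fun t : ℝ => ζ.waveMap n y (x + t • Pi.single i 1))
      (ζ.dispMap i * ζ.waveMap n y x) 0 := by
  simp only [waveMap_add_smul_single]
  simpa using (hasDerivAt_exp_smul_const (ζ.dispMap i) (0 : ℝ)).mul_const (ζ.waveMap n y x)

/-- The weight that is given by the plane wave factor. -/
def waveWeight (x : Fin 3 → ℝ) : C(ζ.D, ℂ) := ζ.weight (ζ.waveMap n y x)

lemma contDiff_waveWeight : ContDiff ℝ (⊤ : ℕ∞) (ζ.waveWeight n y) := by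
  have h := ζ.contDiff_waveMap n y
  exact (((pullback ζ.left).restrictScalars ℝ).contDiff.comp h).mul
    (((pullback ζ.right).restrictScalars ℝ).contDiff.comp h)

lemma hasDerivAt_waveWeight (x : Fin 3 → ℝ) (i : Fin 3) :
    HasDerivAt (fun t : ℝ => ζ.waveWeight n y (x + t • Pi.single i 1))
      ((pullback ζ.left (ζ.dispMap i) + pullback ζ.right (ζ.dispMap i)) * ζ.waveWeight n y x) 0 := by
  have h := ζ.hasDerivAt_waveMap n y x i
  have h1 := ((pullback ζ.left).restrictScalars ℝ).hasFDerivAt.comp_hasDerivAt 0 h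
  have h2 := ((pullback ζ.right).restrictScalars ℝ).hasFDerivAt.comp_hasDerivAt 0 h
  refine (h1.mul h2).congr_deriv ?_
  simp only [ContinuousLinearMap.coe_restrictScalars', Function.comp_apply, zero_smul, add_zero,
    pullback_mul, waveWeight, weight]
  ring

/-- The elliptic flow of a spectral measure on an open set of solvable times. -/
def flow {O : Set (Fin 3 → ℝ)} (hO : IsOpen O)
    (hs : ∀ x ∈ O, ζ.dressing.Solvable (ζ.waveWeight n y x)) :
    EllipticFlow E.e E.g C(ζ.spec, ℂ) (smoothOn O) :=
  ζ.dressing.ellipticFlow hO (ζ.contDiff_waveWeight n y) hs (fun _ => ζ.dressing_Φ_weight _)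
    ζ.kMap ζ.KMap ζ.kMap_mul_kMap (fun i => Pi.single i 1)
    (fun x => ζ.dispMap_zero ▸ ζ.hasDerivAt_waveWeight n y x 0)
    (fun x => ζ.dispMap_one ▸ ζ.hasDerivAt_waveWeight n y x 1)
    (fun x => ζ.dispMap_two ▸ ζ.hasDerivAt_waveWeight n y x 2)
    ζ.dressing_degenerate₁ ζ.dressing_degenerate₂ ζ.dressing_degenerate₃

end Curve.SpectralMeasure

/-! ### Smooth functions along the first coordinate -/

section Lines

variable {O : Set (Fin 3 → ℝ)} (hO : IsOpen O) (x : Fin 3 → ℝ)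

lemma hasDerivAt_update_of_smoothOn (F : smoothOn O) {s : ℝ} (hs : Function.update x 0 s ∈ O) :
    HasDerivAt (fun s => (F : (Fin 3 → ℝ) → ℂ) (Function.update x 0 s))
      ((dirDeriv hO (Pi.single 0 1) F : (Fin 3 → ℝ) → ℂ) (Function.update x 0 s)) s := by
  rw [dirDeriv_apply, Set.indicator_of_mem hs]
  exact (smoothOn.differentiableAt hO F hs).hasFDerivAt.comp_hasDerivAt s (hasDerivAt_update x 0 s)

lemma continuousOn_update_of_smoothOn (F : smoothOn O) {I : Set ℝ}
    (hI : ∀ s ∈ I, Function.update x 0 s ∈ O) :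
    ContinuousOn (fun s => (F : (Fin 3 → ℝ) → ℂ) (Function.update x 0 s)) I :=
  (mem_smoothOn.1 F.2).continuousOn.comp (by fun_prop) hI

end Lines

namespace Curve.SpectralMeasure

variable {E : Curve} (ζ : E.SpectralMeasure) (n : ℤ) (y : ℕ →₀ ℝ)

/-! ### The linear integral equation as a dressing problem -/

@[simp]
lemma waveMap_apply (x : Fin 3 → ℝ) (κ : ζ.spec) : ζ.waveMap n y x κ = E.planeWave n y x κ := rfl

@[simp]
lemma waveWeight_apply (x : Fin 3 → ℝ) (p : ζ.D) : ζ.waveWeight n y x p =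
    E.planeWave n y x p.1.1 * E.planeWave n y x p.1.2 := rfl

lemma integral_eq_meas (F : E.Pt → E.Pt → ℂ) :
    ζ.integral F = ∫ p, ζ.dens p.1 * F p.1.1 p.1.2 ∂ζ.meas :=
  (ζ.integral_meas fun p => ζ.dens p * F p.1 p.2).symm

variable {n y}

/-- Dividing by the nowhere zero plane wave removes the outer factor `ρ(κ)`; the remaining `ρ(λ)
ρ(λ')` under the integral is the weight. -/
lemma integralEq_iff {x : Fin 3 → ℝ} {r W : E.Pt → ℂ} {w : C(ζ.spec, ℂ)}
    (hW : ∀ κ : ζ.spec, W κ = E.planeWave n y x κ * w κ) :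
    ζ.IntegralEq n y x r W ↔ ∀ κ : ζ.spec, E.planeWave n y x κ *
      (w + ζ.dressing.S (ζ.waveWeight n y x * pullback ζ.left w)) κ = r κ := by
  refine Subtype.forall'.trans (forall_congr' fun κ => ?_)
  rw [hW κ, ContinuousMap.add_apply, mul_add, dressing_S_apply, integral_eq_meas,
    ← integral_const_mul]
  have h : ∀ p : ζ.D, ζ.dens p.1 * (E.planeWave n y x κ * E.kernel κ p.1.2 *
      E.planeWave n y x p.1.2 * W p.1.1) = E.planeWave n y x κ * (ζ.dens p.1 * E.kernel κ p.1.2 *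
      (ζ.waveWeight n y x * pullback ζ.left w) p) := fun p => by
    have hp : W p.1.1 = E.planeWave n y x p.1.1 * w (ζ.left p) := hW (ζ.left p)
    rw [hp, ContinuousMap.mul_apply, waveWeight_apply, pullback_apply]
    ring
  simp only [h]

lemma solvable_of_homogeneousTrivial {x : Fin 3 → ℝ} (hx : ζ.HomogeneousTrivial n y x) :
    ζ.dressing.Solvable (ζ.waveWeight n y x) := by
  classical
  refine isUnit_one_add_of_isCompactOperator (ζ.isCompactOperator_weighted _) fun w hw => ?_
  -- Extension by zero: the hypothesis speaks of functions on all of `E.Pt`, but only their values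
  -- on the spectral set matter.
  let W : E.Pt → ℂ := fun κ =>
    if h : κ ∈ ζ.spec then E.planeWave n y x κ * w ⟨κ, h⟩ else 0
  have hW : ∀ κ : ζ.spec, W κ = E.planeWave n y x κ * w κ := fun κ => by simp [W]
  have hc : ContinuousOn W ζ.spec := by
    rw [continuousOn_iff_continuous_domRestrict]
    exact (ζ.waveMap n y x * w).continuous.congr fun κ => (hW κ).symm
  have h0 := hx W hc ((ζ.integralEq_iff hW).2 fun κ => by
    rw [Dressing.weighted_apply] at hw
    exact (congr_arg (fun v : C(ζ.spec, ℂ) => E.planeWave n y x κ * v κ) hw).trans (mul_zero _))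
  ext κ
  have := h0 κ κ.2
  rw [hW κ] at this
  exact (mul_eq_zero.1 this).resolve_left (E.planeWave_ne_zero n y x κ)

/-- Unique solvability forces `u_n/ρ_n` to be the dressed symbol, whichever solution `u` was given;
the two wave factors in the potential combine to the weight. -/
lemma potential_eq_pot {x : Fin 3 → ℝ} {u : E.Pt → E.InfCol} (hu : ζ.IsWaveFunction n y x u)
    (hs : ζ.dressing.Solvable (ζ.waveWeight n y x)) {f f' : E.Symb} {F F' : C(ζ.spec, ℂ)}
    (hF : ∀ κ : ζ.spec, F κ = (f : E.Pt → ℂ) κ) (hF' : ∀ κ : ζ.spec, F' κ = (f' : E.Pt → ℂ) κ) :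
    ζ.potential n y x u f f' = ζ.dressing.pot (ζ.waveWeight n y x) F F' := by
  obtain ⟨hc, heq⟩ := hu f
  let w : C(ζ.spec, ℂ) := ⟨fun κ => u κ f / E.planeWave n y x κ,
    (continuousOn_iff_continuous_domRestrict.1 hc).div (ζ.waveMap n y x).continuous
      fun κ => E.planeWave_ne_zero n y x κ⟩
  have hw : ∀ κ : ζ.spec, u κ f = E.planeWave n y x κ * w κ := fun κ =>
    (mul_div_cancel₀ _ (E.planeWave_ne_zero n y x κ)).symm
  have hwF : w = ζ.dressing.dressed (ζ.waveWeight n y x) F := hs.eq_dressed <| by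
    ext κ
    rw [hF κ]
    exact mul_left_cancel₀ (E.planeWave_ne_zero n y x κ)
      ((ζ.integralEq_iff (W := fun κ => u κ f) hw).1 heq κ)
  rw [potential, integral_eq_meas, Dressing.pot_apply, dressing_Φ_apply, ← hwF]
  congr 1; ext p
  have h1 : u p.1.1 f = E.planeWave n y x p.1.1 * w (ζ.left p) := hw (ζ.left p)
  have h2 : E.c p.1.2 f' = F' (ζ.right p) := (hF' (ζ.right p)).symm
  rw [h1, h2]
  simp only [ContinuousMap.mul_apply, waveWeight_apply]
  change _ = ζ.dens p.1 * (_ * w (ζ.left p) * F' (ζ.right p))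
  ring

/-! ### Decay of the potentials -/

lemma norm_waveWeight_add_le (x : Fin 3 → ℝ) {t c : ℝ}
    (h : ∀ p ∈ ζ.D, (E.k p.1 + E.k p.2).re * t ≤ c) :
    ‖ζ.waveWeight n y (x + t • Pi.single 0 1)‖ ≤ Real.exp c * ‖ζ.waveWeight n y x‖ := by
  refine (ContinuousMap.norm_le _ (by positivity)).2 fun p => ?_
  have hp : ζ.waveWeight n y (x + t • Pi.single 0 1) p =
      Complex.exp ((E.k p.1.1 + E.k p.1.2) * t) * ζ.waveWeight n y x p := by
    have h1 : ∀ κ : ζ.spec, E.planeWave n y (x + t • Pi.single 0 1) κ =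
        Complex.exp (E.k κ * t) * E.planeWave n y x κ := fun κ => by
      rw [E.planeWave_add]
      simp [Fin.sum_univ_succ, E.disp_one]
    have hl := h1 (ζ.left p)
    have hr := h1 (ζ.right p)
    rw [coe_left] at hl
    rw [coe_right] at hr
    rw [waveWeight_apply, waveWeight_apply, hl, hr, add_mul, Complex.exp_add]
    ring
  rw [hp, norm_mul, Complex.norm_exp]
  gcongr
  · simpa using h p p.2
  · exact (ζ.waveWeight n y x).norm_coe_le_norm p

lemma update_zero_eq (x : Fin 3 → ℝ) (s : ℝ) :
    Function.update x 0 s = x + (s - x 0) • Pi.single 0 1 := by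
  ext i
  rcases eq_or_ne i 0 with rfl | hi <;> simp [*]

/-- A shift of `x₁` by `t` multiplies the weight by `exp((k + k') t)`. The hypothesis carries the
factor `s - x 0`, so that one statement serves both ends of the line. -/
lemma waveWeight_isBigO_exp (x : Fin 3 → ℝ) {l : Filter ℝ} {δ : ℝ}
    (h : ∀ᶠ s in l, ∀ p ∈ ζ.D, (E.k p.1 + E.k p.2).re * (s - x 0) ≤ δ * (s - x 0)) :
    (fun s => ζ.waveWeight n y (Function.update x 0 s)) =O[l] fun s => Real.exp (δ * s) := by
  refine Asymptotics.IsBigO.of_bound (Real.exp (-(δ * x 0)) * ‖ζ.waveWeight n y x‖) ?_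
  filter_upwards [h] with s hs
  rw [update_zero_eq]
  refine (ζ.norm_waveWeight_add_le x hs).trans_eq ?_
  rw [Real.norm_of_nonneg (Real.exp_pos _).le, mul_right_comm, ← Real.exp_add]
  ring_nf

lemma flow_isBigO {O : Set (Fin 3 → ℝ)} {hO : IsOpen O}
    {hs : ∀ x ∈ O, ζ.dressing.Solvable (ζ.waveWeight n y x)} {l : Filter ℝ}
    {γ : ℝ → Fin 3 → ℝ} {φ : ℝ → ℝ} (hφ : Tendsto φ l (𝓝 0)) (hγ : ∀ᶠ s in l, γ s ∈ O)
    (hW : (fun s => ζ.waveWeight n y (γ s)) =O[l] φ) {F : smoothOn O}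
    (hF : F ∈ (ζ.flow n y hO hs).potentialAlgebra) :
    (fun s => (F : (Fin 3 → ℝ) → ℂ) (γ s)) =O[l] φ := by
  refine EllipticFlow.isBigO_of_mem _ hφ (fun f f' => ?_) hF
  refine ((Dressing.pot_isBigO (A := ζ.dressing) (hW.trans_tendsto hφ) f f').trans hW).congr' ?_
    EventuallyEq.rfl
  filter_upwards [hγ] with s hs'
  exact (Dressing.potOn_apply_of_mem (hω := ζ.contDiff_waveWeight n y) (hs := hs) f f' hs').symm

end Curve.SpectralMeasure

/-! ### Integral representations on half lines -/

namespace Curve.SpectralMeasure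

variable {E : Curve} (ζ : E.SpectralMeasure) {n : ℤ} {y : ℕ →₀ ℝ} {O : Set (Fin 3 → ℝ)}
  {hO : IsOpen O} {hs : ∀ x ∈ O, ζ.dressing.Solvable (ζ.waveWeight n y x)}

lemma continuous_re_add : Continuous fun p : E.Pt × E.Pt => (E.k p.1 + E.k p.2).re :=
  Complex.continuous_re.comp
    ((E.continuous_k.comp continuous_fst).add (E.continuous_k.comp continuous_snd))

lemma flow_integral_Iic {Q : smoothOn O} (hQ : Q ∈ (ζ.flow n y hO hs).potentialAlgebra)
    (hQ' : (ζ.flow n y hO hs).D₁ Q ∈ (ζ.flow n y hO hs).potentialAlgebra)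
    (hre : ∀ p ∈ ζ.D, 0 < (E.k p.1 + E.k p.2).re) {x : Fin 3 → ℝ}
    (hx : ∀ s ≤ x 0, Function.update x 0 s ∈ O) :
    IntegrableOn (fun s => ((ζ.flow n y hO hs).D₁ Q : (Fin 3 → ℝ) → ℂ) (Function.update x 0 s))
      (Set.Iic (x 0)) ∧ (Q : (Fin 3 → ℝ) → ℂ) x = ∫ s in Set.Iic (x 0),
        ((ζ.flow n y hO hs).D₁ Q : (Fin 3 → ℝ) → ℂ) (Function.update x 0 s) := by
  -- Compactness of `D` turns pointwise positivity into a uniform rate of decay.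
  obtain ⟨δ, hδ, hδre⟩ := ζ.compact.exists_forall_le' continuous_re_add.continuousOn hre
  have hφ : Tendsto (fun s => Real.exp (δ * s)) atBot (𝓝 0) :=
    Real.tendsto_exp_atBot.comp (tendsto_id.const_mul_atBot hδ)
  have hW := ζ.waveWeight_isBigO_exp (n := n) (y := y) x (l := atBot) (δ := δ) <| by
    filter_upwards [Iic_mem_atBot (x 0)] with s hsx p hp
    exact mul_le_mul_of_nonpos_right (hδre p hp) (sub_nonpos.2 hsx)
  have hO' : ∀ᶠ s in atBot, Function.update x 0 s ∈ O := (eventually_le_atBot (x 0)).mono hx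
  have key := integral_Iic_of_hasDerivAt_of_isBigO_exp hδ
    (fun s hsx => hasDerivAt_update_of_smoothOn hO x Q (hx s hsx))
    (continuousOn_update_of_smoothOn x ((ζ.flow n y hO hs).D₁ Q) hx)
    (ζ.flow_isBigO hφ hO' hW hQ) (ζ.flow_isBigO hφ hO' hW hQ')
  rwa [Function.update_eq_self] at key

lemma flow_integral_Ici {Q : smoothOn O} (hQ : Q ∈ (ζ.flow n y hO hs).potentialAlgebra)
    (hQ' : (ζ.flow n y hO hs).D₁ Q ∈ (ζ.flow n y hO hs).potentialAlgebra)
    (hre : ∀ p ∈ ζ.D, (E.k p.1 + E.k p.2).re < 0) {x : Fin 3 → ℝ}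
    (hx : ∀ s ≥ x 0, Function.update x 0 s ∈ O) :
    IntegrableOn (fun s => ((ζ.flow n y hO hs).D₁ Q : (Fin 3 → ℝ) → ℂ) (Function.update x 0 s))
      (Set.Ici (x 0)) ∧ (Q : (Fin 3 → ℝ) → ℂ) x = -∫ s in Set.Ici (x 0),
        ((ζ.flow n y hO hs).D₁ Q : (Fin 3 → ℝ) → ℂ) (Function.update x 0 s) := by
  obtain ⟨δ, hδ, hδre⟩ := ζ.compact.exists_forall_le' continuous_re_add.neg.continuousOn
    (a := 0) fun p hp => neg_pos.2 (hre p hp)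
  have hφ : Tendsto (fun s => Real.exp (-δ * s)) atTop (𝓝 0) :=
    Real.tendsto_exp_atBot.comp (tendsto_id.const_mul_atTop_of_neg (neg_lt_zero.2 hδ))
  have hW := ζ.waveWeight_isBigO_exp (n := n) (y := y) x (l := atTop) (δ := -δ) <| by
    filter_upwards [Ici_mem_atTop (x 0)] with s hsx p hp
    exact mul_le_mul_of_nonneg_right (le_neg_of_le_neg (hδre p hp)) (sub_nonneg.2 hsx)
  have hO' : ∀ᶠ s in atTop, Function.update x 0 s ∈ O := (eventually_ge_atTop (x 0)).mono hx
  have key := integral_Ici_of_hasDerivAt_of_isBigO_exp hδ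
    (fun s hsx => hasDerivAt_update_of_smoothOn hO x Q (hx s hsx))
    (continuousOn_update_of_smoothOn x ((ζ.flow n y hO hs).D₁ Q) hx)
    (ζ.flow_isBigO hφ hO' hW hQ) (ζ.flow_isBigO hφ hO' hW hQ')
  rwa [Function.update_eq_self] at key

end Curve.SpectralMeasure

end EllKP

end

/-! ### The theorem -/

theorem mainTheorem1 (E : EllKP.Curve) (ζ : E.SpectralMeasure) (n : ℤ) (y : ℕ →₀ ℝ)
    (O : Set (Fin 3 → ℝ)) (hO : IsOpen O)
    (hom : ∀ x ∈ O, ζ.HomogeneousTrivial n y x)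
    (u : (Fin 3 → ℝ) → E.Pt → E.InfCol)
    (hu : ∀ x ∈ O, ζ.IsWaveFunction n y x (u x))
    (U : (Fin 3 → ℝ) → E.InfMat) (hU : ∀ x, U x = ζ.potential n y x (u x))
    (un vn wn : (Fin 3 → ℝ) → ℂ)
    (hun : ∀ x, un x = EllKP.Curve.ellEntry (U x) 2 0)
    (hvn : ∀ x, vn x = 1 + E.g⁻¹ * EllKP.Curve.ellEntry (U x) 3 2)
    (hwn : ∀ x, wn x = 1 - EllKP.Curve.ellEntry (U x) 1 0) :
    ContDiffOn ℝ (⊤ : ℕ∞) un O ∧ ContDiffOn ℝ (⊤ : ℕ∞) vn O ∧ ContDiffOn ℝ (⊤ : ℕ∞) wn O ∧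
    ∃ Q : (Fin 3 → ℝ) → ℂ,
      -- `Q` is an antiderivative `∂₁⁻¹ ∂₂² uₙ`
      ContDiffOn ℝ (⊤ : ℕ∞) Q O ∧
      (∀ x ∈ O, EllKP.pd 1 Q x = EllKP.pd 2 (EllKP.pd 2 un) x) ∧
      -- it is the integral from `-∞` if the plane waves decay there, and similarly at `+∞`
      ((∀ p ∈ ζ.D, 0 < (E.k p.1 + E.k p.2).re) →
        ∀ x, (∀ s ≤ x 0, Function.update x 0 s ∈ O) →
          IntegrableOn (fun s => EllKP.pd 2 (EllKP.pd 2 un) (Function.update x 0 s))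
            (Set.Iic (x 0)) ∧
          Q x = ∫ s in Set.Iic (x 0), EllKP.pd 2 (EllKP.pd 2 un) (Function.update x 0 s)) ∧
      ((∀ p ∈ ζ.D, (E.k p.1 + E.k p.2).re < 0) →
        ∀ x, (∀ s ≥ x 0, Function.update x 0 s ∈ O) →
          IntegrableOn (fun s => EllKP.pd 2 (EllKP.pd 2 un) (Function.update x 0 s))
            (Set.Ici (x 0)) ∧
          Q x = -∫ s in Set.Ici (x 0), EllKP.pd 2 (EllKP.pd 2 un) (Function.update x 0 s)) ∧
      EllKP.SolvesEllCoupledKP E.e E.g O un vn wn Q := by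
  have hs : ∀ x ∈ O, ζ.dressing.Solvable (ζ.waveWeight n y x) := fun x hx =>
    ζ.solvable_of_homogeneousTrivial (hom x hx)
  set A := ζ.flow n y hO hs with hA
  -- For the labels that occur, the symbols restricted to the spectral set are the labels of the
  -- flow; this links `U` to the continuous functions being dressed.
  have hl : ∀ i ∈ ({0, 1, 2, 3} : Set ℤ), ∀ κ : ζ.spec,
      A.label i κ = (E.labelSymb i : E.Pt → ℂ) κ := by
    rintro i (rfl | rfl | rfl | rfl) κ
    · rw [A.label_zero]
      simp [EllKP.Curve.labelSymb]
    · rw [A.label_one]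
      simp [EllKP.Curve.labelSymb]
      rfl
    · rw [A.label_two]
      simp [EllKP.Curve.labelSymb]
      rfl
    · rw [A.label_three]
      simp [EllKP.Curve.labelSymb, show Odd (3 : ℤ) by decide, show (3 : ℤ) / 2 = 1 by norm_num]
      rfl
  have hentry : ∀ x ∈ O, ∀ i ∈ ({0, 1, 2, 3} : Set ℤ), ∀ j ∈ ({0, 1, 2, 3} : Set ℤ),
      EllKP.Curve.ellEntry (U x) i j = (A.entry i j : (Fin 3 → ℝ) → ℂ) x := by
    intro x hx i hi j hj
    rw [hU x]
    exact (ζ.potential_eq_pot (hu x hx) (hs x hx) (hl i hi) (hl j hj)).trans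
      (EllKP.Dressing.potOn_apply_of_mem (hω := ζ.contDiff_waveWeight n y) (hs := hs) _ _ hx).symm
  have hun' : Set.EqOn un (A.entry 2 0) O := fun x hx => by
    rw [hun, hentry x hx 2 (by simp) 0 (by simp)]
  have hvn' : Set.EqOn vn (1 + E.g⁻¹ • A.entry 3 2 : EllKP.smoothOn O) O := fun x hx => by
    rw [hvn, hentry x hx 3 (by simp) 2 (by simp)]; rfl
  have hwn' : Set.EqOn wn (1 - A.entry 1 0 : EllKP.smoothOn O) O := fun x hx => by
    rw [hwn, hentry x hx 1 (by simp) 0 (by simp)]; rfl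
  -- Formally `∂₂² log τ`, since `U^[2,0]` and `U^[3,0] - U^[2,1]` play the roles of `∂₁ log τ` and
  -- `∂₂ log τ`.
  set Q := A.D₂ (A.entry 3 0 - A.entry 2 1) with hQ
  have hpd : ∀ x ∈ O, EllKP.pd 2 (EllKP.pd 2 un) x = (A.D₁ Q : (Fin 3 → ℝ) → ℂ) x := fun x hx => by
    rw [hQ, A.D₁_D₂_entry_sub_entry]
    exact A.pd_two_eqOn hO rfl (A.pd_two_eqOn hO rfl hun') hx
  have hQmem : Q ∈ A.potentialAlgebra := A.D₂_mem (sub_mem (A.U_mem _ _) (A.U_mem _ _))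
  have hRmem : A.D₁ Q ∈ A.potentialAlgebra := by
    -- Rewriting `D₁ Q` as `D₂ (D₂ (A.entry 2 0))` makes closure under `D₂` suffice.
    rw [hQ, A.D₁_D₂_entry_sub_entry]
    exact A.D₂_mem (A.D₂_mem (A.U_mem _ _))
  refine ⟨(EllKP.mem_smoothOn.1 (A.entry 2 0).2).congr hun',
    (EllKP.mem_smoothOn.1 (1 + E.g⁻¹ • A.entry 3 2 : EllKP.smoothOn O).2).congr hvn',
    (EllKP.mem_smoothOn.1 (1 - A.entry 1 0 : EllKP.smoothOn O).2).congr hwn',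
    Q, Q.2, fun x hx => ?_, fun hre x hx => ?_, fun hre x hx => ?_, ?_⟩
  · rw [hpd x hx]
    exact A.pd_one_eqOn hO rfl (Set.eqOn_refl _ _) hx
  · have hEq : Set.EqOn (fun s => EllKP.pd 2 (EllKP.pd 2 un) (Function.update x 0 s))
        (fun s => (A.D₁ Q : (Fin 3 → ℝ) → ℂ) (Function.update x 0 s)) (Set.Iic (x 0)) :=
      fun s hsx => hpd _ (hx s hsx)
    rw [integrableOn_congr_fun hEq measurableSet_Iic, setIntegral_congr_fun measurableSet_Iic hEq]
    exact ζ.flow_integral_Iic hQmem hRmem hre hx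
  · have hEq : Set.EqOn (fun s => EllKP.pd 2 (EllKP.pd 2 un) (Function.update x 0 s))
        (fun s => (A.D₁ Q : (Fin 3 → ℝ) → ℂ) (Function.update x 0 s)) (Set.Ici (x 0)) :=
      fun s hsx => hpd _ (hx s hsx)
    rw [integrableOn_congr_fun hEq measurableSet_Ici, setIntegral_congr_fun measurableSet_Ici hEq]
    exact ζ.flow_integral_Ici hQmem hRmem hre hx
  · exact A.solvesEllCoupledKP hO rfl rfl rfl E.g_ne_zero hun' hvn' hwn'
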